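/- Let $M\ge 2$ be an integer and let $W\subset\mathbb{R}^M$ be a convex body, i.e. a compact convex set with nonempty interior. For a finite set $X\subset\mathbb{R}^M$ and an $M$-element subset $S\subset X$, let $\deg(S;X)$ be the number of points $z\in X\setminus S$ such that the simplex $\operatorname{conv}(S\cup\{z\})$ is empty in $X$, meaning that $\operatorname{conv}(S\cup\{z\})\cap X=S\cup\{z\}$, and let $\deg(X)$ be the maximum of $\deg(S;X)$ over all $M$-element subsets $S$ of $X$ (with $\deg(X)=0$ if $X$ has fewer than $M$ points). For each $n$ let $\xi_n$ be a set of $n$ random points chosen independently and uniformly (with respect to Lebesgue measure) from $W$. Then: (i) There is an $N\in\mathbb{N}$ such that for every integer $k\ge 0$ there is a constant $c>0$, not depending on $n$, with $\mathbb{E}\left[\deg(\xi_n)^k\right]\ge c\,n^k/\log n$ for all $n\ge N$. (ii) $\deg(\xi_n)\to\infty$ in probability as $n\to\infty$, that is, $\mathbb{P}(\deg(\xi_n)\le m)\to 0$ as $n\to\infty$ for every $m\in\mathbb{N}$. -/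

import Mathlib

open MeasureTheory ProbabilityTheory Filter Topology

noncomputable section

/-- The number of points `z` of `X` outside `s` such that the simplex `conv (s ∪ {z})` is empty
in `X`, that is, contains no points of `X` other than those of `s ∪ {z}`. -/
def subsetDegree {M : ℕ} (X s : Finset (EuclideanSpace ℝ (Fin M))) : ℕ :=
  Set.ncard {z : EuclideanSpace ℝ (Fin M) | z ∈ X ∧ z ∉ s ∧
    convexHull ℝ (insert z (s : Set (EuclideanSpace ℝ (Fin M)))) ∩ X =
      insert z (s : Set (EuclideanSpace ℝ (Fin M)))}

/-- The degree of a finite set `X ⊆ ℝ^M`: the maximum of the degrees of its `M`-element subsets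
(and `0` if there are none). -/
def maxDegree {M : ℕ} (X : Finset (EuclideanSpace ℝ (Fin M))) : ℕ :=
  (X.powersetCard M).sup (subsetDegree X)

open Classical in
/-- The finite set formed by the points of a sample `(x_0, …, x_{n-1})`. -/
def sampleSet {M n : ℕ} (x : Fin n → EuclideanSpace ℝ (Fin M)) :
    Finset (EuclideanSpace ℝ (Fin M)) :=
  Finset.univ.image x

/-- The joint law of `n` independent points, each uniformly distributed in `W`
(normalized Lebesgue measure on `W`). -/
def uniformSampleLaw {M : ℕ} (W : Set (EuclideanSpace ℝ (Fin M))) (n : ℕ) :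
    Measure (Fin n → EuclideanSpace ℝ (Fin M)) :=
  Measure.pi fun _ => cond volume W

end

/-!
The maximal degree is large because some `M` sample points lie exceptionally close together. Divide
a cube inside `W` into `L ^ M` equal cells with `L ^ (M - 1)` of order `n`. The number of *clusters*,
that is, of `M`-element sets of sample points in a common cell, then has a mean bounded away from
zero, and its second moment is comparable to the square of the mean plus the mean
(`integral_clusterCount_sq_le`). The convex hull of two cells is a tube of volume `O(1 / n)`
(`convexHull_gridCell_union_subset`), so for a given cluster any other sample point spans an empty
simplex with probability bounded below. All events are intersections of conditions on single sample
points, so their probabilities are plain products.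

*Moments.* The product of the number of clusters with the maximal degree dominates the sum of the
degrees of all clusters, whose mean has order `n`. By the Cauchy-Schwarz inequality the second
moment of the degree has order `n ^ 2` (`sq_le_integral_indexMaxDegree_sq`). As the degree is at most
`n`, its mean has order `n`, and Jensen's inequality gives order `n ^ k` for the `k`-th moment.
This is stronger than the bound with the factor `1 / log n`.

*Divergence in probability.* Choose `L` slightly smaller, so that the mean number of clusters is a
large constant; by Chebyshev's inequality a cluster exists with probability near one. Let `J ^ M` be
a large multiple of `L`. Then the cells within distance `J` of the cluster contain many sample points
with high probability, while the hulls of the cluster cell with these cells are so short that the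
probability that any of them contains a further sample point is `O(J / L) = o(1)`. Hence all nearby
sample points span empty simplices with the cluster (`pi_real_indexMaxDegree_le`).

The degree is handled through its version for index sets, `indexMaxDegree`, which is measurable and
almost surely equal to the degree of the sample.
-/

/-! ### Probabilities of product events -/

section Product

variable {E : Type*} [MeasurableSpace E] {μ : Measure E} [IsProbabilityMeasure μ] {n : ℕ}

theorem pi_real_forall_mem (A : Finset (Fin n)) (F : Fin n → Set E) :
    (Measure.pi fun _ : Fin n => μ).real {x | ∀ i ∈ A, x i ∈ F i} = ∏ i ∈ A, μ.real (F i) := by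
  classical
  have h : {x : Fin n → E | ∀ i ∈ A, x i ∈ F i} =
      Set.univ.pi fun i => if i ∈ A then F i else Set.univ := by
    ext x
    simp only [Set.mem_ofPred_eq, Set.mem_pi, Set.mem_univ, true_implies]
    refine forall_congr' fun i => ?_
    split_ifs with hi <;> simp [hi]
  rw [h, measureReal_def, Measure.pi_pi, ENNReal.toReal_prod]
  simp only [← measureReal_def]
  rw [← Finset.prod_subset (Finset.subset_univ A)]
  · exact Finset.prod_congr rfl fun i hi => by simp [hi]
  · intro i _ hi
    simp [hi]

theorem measurableSet_forall_mem (A : Finset (Fin n)) {F : Fin n → Set E}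
    (hF : ∀ i, MeasurableSet (F i)) : MeasurableSet {x : Fin n → E | ∀ i ∈ A, x i ∈ F i} := by
  have : {x : Fin n → E | ∀ i ∈ A, x i ∈ F i} = ⋂ i ∈ A, (fun x => x i) ⁻¹' F i := by
    ext; simp
  rw [this]
  exact Finset.measurableSet_biInter _ fun i _ => measurable_pi_apply i (hF i)

end Product

/-! ### Clusters: index sets whose points share a cell -/

section Cluster

variable {E κ : Type*}

/-- The event that all sample points with index in `I` lie in one common cell `Q v`. -/
def clusterEvent {n : ℕ} (Q : κ → Set E) (I : Finset (Fin n)) : Set (Fin n → E) :=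
  {x | ∃ v, ∀ i ∈ I, x i ∈ Q v}

open Classical in
/-- The number of `r`-element index sets that form a cluster, as a real number. -/
noncomputable def clusterCount {n : ℕ} (Q : κ → Set E) (r : ℕ) (x : Fin n → E) : ℝ :=
  ∑ I ∈ (Finset.univ : Finset (Fin n)).powersetCard r, (clusterEvent Q I).indicator 1 x

theorem clusterEvent_eq_iUnion {n : ℕ} (Q : κ → Set E) (I : Finset (Fin n)) :
    clusterEvent Q I = ⋃ v, {x : Fin n → E | ∀ i ∈ I, x i ∈ Q v} := by
  ext; simp [clusterEvent]

theorem clusterCount_sq {n : ℕ} (Q : κ → Set E) (r : ℕ) (x : Fin n → E) :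
    clusterCount Q r x ^ 2 = ∑ I ∈ (Finset.univ : Finset (Fin n)).powersetCard r,
      ∑ I' ∈ (Finset.univ : Finset (Fin n)).powersetCard r,
        (clusterEvent Q I ∩ clusterEvent Q I').indicator 1 x := by
  classical
  rw [sq, clusterCount, Finset.sum_mul_sum]
  refine Finset.sum_congr rfl fun I _ => Finset.sum_congr rfl fun I' _ => ?_
  rw [Set.inter_indicator_one]
  rfl

variable [MeasurableSpace E] {μ : Measure E} [IsProbabilityMeasure μ] {n : ℕ}
  [Fintype κ] {Q : κ → Set E} {q : ℝ}

theorem measurableSet_clusterEvent (hQ : ∀ v, MeasurableSet (Q v)) (I : Finset (Fin n)) :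
    MeasurableSet (clusterEvent Q I) := by
  rw [clusterEvent_eq_iUnion]
  exact MeasurableSet.iUnion fun v => measurableSet_forall_mem I fun _ => hQ v

theorem pi_real_clusterEvent (hQ : ∀ v, MeasurableSet (Q v))
    (hdisj : Pairwise (Function.onFun Disjoint Q)) (hq : ∀ v, μ.real (Q v) = q)
    {I : Finset (Fin n)} (hI : I.Nonempty) :
    (Measure.pi fun _ : Fin n => μ).real (clusterEvent Q I) = Fintype.card κ * q ^ I.card := by
  rw [clusterEvent_eq_iUnion, measureReal_iUnion_fintype]
  · simp [pi_real_forall_mem, hq]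
  · intro v w hvw
    obtain ⟨i, hi⟩ := hI
    refine Set.disjoint_left.2 fun x hx hx' => ?_
    exact Set.disjoint_left.1 (hdisj hvw) (hx i hi) (hx' i hi)
  · exact fun v => measurableSet_forall_mem I fun _ => hQ v

/-- Two clusters are either in different cells, which is at most as likely as for independent
events, or in the same cell, and then only the points of `I' \ I` are new. -/
theorem pi_real_clusterEvent_inter_le
    (hdisj : Pairwise (Function.onFun Disjoint Q)) (hq : ∀ v, μ.real (Q v) = q)
    (I I' : Finset (Fin n)) :
    (Measure.pi fun _ : Fin n => μ).real (clusterEvent Q I ∩ clusterEvent Q I') ≤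
      (Fintype.card κ * q ^ I.card) * (Fintype.card κ * q ^ I'.card) +
        Fintype.card κ * q ^ I.card * q ^ (I' \ I).card := by
  classical
  rcases isEmpty_or_nonempty κ with hκ | ⟨⟨v₀⟩⟩
  · have : clusterEvent Q I = ∅ := by
      ext x; simp [clusterEvent]
    simp [this]
  have hq0 : 0 ≤ q := hq v₀ ▸ measureReal_nonneg
  set P := Measure.pi fun _ : Fin n => μ
  have hsub : clusterEvent Q I ∩ clusterEvent Q I' ⊆
      (⋃ v : κ × κ, {x | v.1 ≠ v.2 ∧ (∀ i ∈ I, x i ∈ Q v.1) ∧ ∀ i ∈ I', x i ∈ Q v.2}) ∪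
        ⋃ v, {x | ∀ i ∈ I ∪ I', x i ∈ Q v} := by
    rintro x ⟨⟨v, hv⟩, ⟨w, hw⟩⟩
    by_cases hvw : v = w
    · subst hvw
      refine Or.inr (Set.mem_iUnion.2 ⟨v, fun i hi => ?_⟩)
      rcases Finset.mem_union.1 hi with h | h
      exacts [hv i h, hw i h]
    · exact Or.inl (Set.mem_iUnion.2 ⟨(v, w), hvw, hv, hw⟩)
  refine (measureReal_mono hsub).trans ((measureReal_union_le _ _).trans (add_le_add ?_ ?_))
  · refine (measureReal_iUnion_fintype_le _).trans ?_
    have hterm : ∀ v : κ × κ,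
        P.real {x | v.1 ≠ v.2 ∧ (∀ i ∈ I, x i ∈ Q v.1) ∧ ∀ i ∈ I', x i ∈ Q v.2} ≤
          q ^ I.card * q ^ I'.card := by
      intro v
      by_cases hvw : v.1 = v.2
      · simp only [hvw, ne_eq, not_true_eq_false, false_and, Set.ofPred_false, measureReal_empty]
        positivity
      by_cases hd : Disjoint I I'
      · have h2 : {x : Fin n → E | v.1 ≠ v.2 ∧ (∀ i ∈ I, x i ∈ Q v.1) ∧ ∀ i ∈ I', x i ∈ Q v.2} ⊆
            {x | ∀ i ∈ I ∪ I', x i ∈ if i ∈ I then Q v.1 else Q v.2} := by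
          rintro x ⟨-, h1, h2⟩ i hi
          split_ifs with h
          · exact h1 i h
          · exact h2 i ((Finset.mem_union.1 hi).resolve_left h)
        refine (measureReal_mono h2).trans (le_of_eq ?_)
        rw [pi_real_forall_mem, Finset.prod_union hd]
        congr 1
        · rw [Finset.prod_congr rfl fun i hi => by rw [if_pos hi, hq], Finset.prod_const]
        · rw [Finset.prod_congr rfl fun i hi => by
            rw [if_neg (Finset.disjoint_right.1 hd hi), hq], Finset.prod_const]
      · obtain ⟨i, hi, hi'⟩ := Finset.not_disjoint_iff.1 hd
        have : {x : Fin n → E | v.1 ≠ v.2 ∧ (∀ i ∈ I, x i ∈ Q v.1) ∧ ∀ i ∈ I', x i ∈ Q v.2} = ∅ := by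
          ext x
          simp only [Set.mem_ofPred_eq, Set.mem_empty_iff_false, iff_false]
          rintro ⟨-, h1, h2⟩
          exact Set.disjoint_left.1 (hdisj hvw) (h1 i hi) (h2 i hi')
        rw [this, measureReal_empty]
        positivity
    refine (Finset.sum_le_sum fun v _ => hterm v).trans (le_of_eq ?_)
    simp only [Finset.sum_const, Finset.card_univ, Fintype.card_prod, nsmul_eq_mul]
    push_cast
    ring
  · refine (measureReal_iUnion_fintype_le _).trans (le_of_eq ?_)
    have hU : (I ∪ I').card = I.card + (I' \ I).card := by
      rw [← Finset.union_sdiff_self_eq_union, Finset.card_union_of_disjoint Finset.disjoint_sdiff]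
    simp only [P, pi_real_forall_mem, hq, Finset.prod_const, Finset.sum_const, Finset.card_univ,
      nsmul_eq_mul, hU, pow_add, mul_assoc]

/-- The sum is bounded by the one over all subsets of `Fin n`, which factorizes over the indices. -/
theorem sum_powersetCard_pow_card_sdiff_le {r : ℕ} {I : Finset (Fin n)} (hI : I.card = r)
    (hq : 0 ≤ q) :
    ∑ I' ∈ (Finset.univ : Finset (Fin n)).powersetCard r, q ^ (I' \ I).card ≤
      2 ^ r * (1 + q) ^ n := by
  calc ∑ I' ∈ (Finset.univ : Finset (Fin n)).powersetCard r, q ^ (I' \ I).card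
      ≤ ∑ I' ∈ (Finset.univ : Finset (Fin n)).powerset, q ^ (I' \ I).card :=
        Finset.sum_le_sum_of_subset_of_nonneg
          (fun s hs => Finset.mem_powerset.2 (Finset.mem_powersetCard.1 hs).1)
          fun _ _ _ => by positivity
    _ = ∑ I' ∈ (Finset.univ : Finset (Fin n)).powerset, ∏ i ∈ I', if i ∈ I then 1 else q := by
        refine Finset.sum_congr rfl fun I' _ => ?_
        rw [Finset.prod_ite, Finset.prod_const, Finset.prod_const, one_pow, one_mul,
          Finset.sdiff_eq_filter]
    _ = ∏ i, (1 + if i ∈ I then 1 else q) := (Finset.prod_one_add _).symm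
    _ ≤ ∏ i, ((if i ∈ I then 2 else 1) * (1 + q)) := by
        refine Finset.prod_le_prod (fun i _ => ?_) fun i _ => ?_ <;> split_ifs <;> linarith
    _ = 2 ^ r * (1 + q) ^ n := by
        rw [Finset.prod_mul_distrib, Finset.prod_ite_mem, Finset.univ_inter]
        simp [hI]

theorem measurable_clusterCount (hQ : ∀ v, MeasurableSet (Q v)) (r : ℕ) :
    Measurable (clusterCount Q r : (Fin n → E) → ℝ) :=
  Finset.measurable_fun_sum _ fun I _ =>
    measurable_one.indicator (measurableSet_clusterEvent hQ I)

theorem integrable_indicator_one {Ω : Type*} [MeasurableSpace Ω] (P : Measure Ω)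
    [IsFiniteMeasure P] {A : Set Ω} (hA : MeasurableSet A) :
    Integrable (A.indicator (1 : Ω → ℝ)) P :=
  (integrable_const (1 : ℝ)).indicator hA

theorem integral_clusterCount (hQ : ∀ v, MeasurableSet (Q v))
    (hdisj : Pairwise (Function.onFun Disjoint Q)) (hq : ∀ v, μ.real (Q v) = q)
    {r : ℕ} (hr : 0 < r) :
    ∫ x, clusterCount Q r x ∂(Measure.pi fun _ : Fin n => μ) =
      n.choose r * (Fintype.card κ * q ^ r) := by
  unfold clusterCount
  rw [integral_finsetSum _ fun I _ => integrable_indicator_one _ (measurableSet_clusterEvent hQ I)]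
  rw [Finset.sum_congr rfl fun I hI => by
    have hc := (Finset.mem_powersetCard.1 hI).2
    rw [integral_indicator_one (measurableSet_clusterEvent hQ I),
      pi_real_clusterEvent hQ hdisj hq (Finset.card_pos.1 (by omega)), hc]]
  simp

theorem integrable_clusterCount (hQ : ∀ v, MeasurableSet (Q v)) (r : ℕ) :
    Integrable (clusterCount Q r) (Measure.pi fun _ : Fin n => μ) :=
  integrable_finsetSum _ fun I _ => integrable_indicator_one _ (measurableSet_clusterEvent hQ I)

theorem integrable_clusterCount_sq (hQ : ∀ v, MeasurableSet (Q v)) (r : ℕ) :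
    Integrable (fun x => clusterCount Q r x ^ 2) (Measure.pi fun _ : Fin n => μ) := by
  simp only [clusterCount_sq]
  exact integrable_finsetSum _ fun I _ => integrable_finsetSum _ fun I' _ =>
    integrable_indicator_one _
      ((measurableSet_clusterEvent hQ I).inter (measurableSet_clusterEvent hQ I'))

/-- Second moment of the number of clusters; `n.choose r * (card κ * q ^ r)` is its mean. -/
theorem integral_clusterCount_sq_le (hQ : ∀ v, MeasurableSet (Q v))
    (hdisj : Pairwise (Function.onFun Disjoint Q)) (hq : ∀ v, μ.real (Q v) = q) (hq0 : 0 ≤ q)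
    (r : ℕ) :
    ∫ x, clusterCount Q r x ^ 2 ∂(Measure.pi fun _ : Fin n => μ) ≤
      (n.choose r * (Fintype.card κ * q ^ r)) ^ 2 +
        n.choose r * (Fintype.card κ * q ^ r) * (2 ^ r * (1 + q) ^ n) := by
  have hint : ∀ I I' : Finset (Fin n),
      MeasurableSet (clusterEvent Q I ∩ clusterEvent Q I') := fun I I' =>
    (measurableSet_clusterEvent hQ I).inter (measurableSet_clusterEvent hQ I')
  simp only [clusterCount_sq]
  rw [integral_finsetSum _ fun I _ => integrable_finsetSum _ fun I' _ =>
    integrable_indicator_one _ (hint I I')]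
  have hle : ∀ I ∈ (Finset.univ : Finset (Fin n)).powersetCard r,
      ∫ x, ∑ I' ∈ (Finset.univ : Finset (Fin n)).powersetCard r,
        (clusterEvent Q I ∩ clusterEvent Q I').indicator (1 : (Fin n → E) → ℝ) x
          ∂(Measure.pi fun _ : Fin n => μ) ≤
      n.choose r * ((Fintype.card κ * q ^ r) * (Fintype.card κ * q ^ r)) +
        Fintype.card κ * q ^ r * (2 ^ r * (1 + q) ^ n) := by
    intro I hI
    have hc := (Finset.mem_powersetCard.1 hI).2
    rw [integral_finsetSum _ fun I' _ => integrable_indicator_one _ (hint I I')]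
    calc _ ≤ ∑ I' ∈ (Finset.univ : Finset (Fin n)).powersetCard r,
        ((Fintype.card κ * q ^ r) * (Fintype.card κ * q ^ r) +
          Fintype.card κ * q ^ r * q ^ (I' \ I).card) := by
          refine Finset.sum_le_sum fun I' hI' => ?_
          have hc' := (Finset.mem_powersetCard.1 hI').2
          rw [integral_indicator_one (hint I I')]
          simpa only [hc, hc'] using pi_real_clusterEvent_inter_le hdisj hq I I'
      _ ≤ _ := by
          rw [Finset.sum_add_distrib, Finset.sum_const, ← Finset.mul_sum]
          refine add_le_add (le_of_eq (by simp)) ?_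
          gcongr
          exact sum_powersetCard_pow_card_sdiff_le hc hq0
  refine (Finset.sum_le_sum hle).trans (le_of_eq ?_)
  simp
  ring

end Cluster

/-! ### Grid cells in a convex body -/

section Grid

variable {M : ℕ}

/-- The half-open axis-parallel cube with corner `lo` and side `h`. -/
def halfOpenCube (lo : Fin M → ℝ) (h : ℝ) : Set (EuclideanSpace ℝ (Fin M)) :=
  {x | ∀ i, lo i ≤ x i ∧ x i < lo i + h}

theorem halfOpenCube_eq_preimage (lo : Fin M → ℝ) (h : ℝ) :
    halfOpenCube lo h =
      WithLp.ofLp ⁻¹' (Set.univ.pi fun i => Set.Ico (lo i) (lo i + h)) := by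
  ext x
  simp [halfOpenCube]

theorem measurableSet_halfOpenCube (lo : Fin M → ℝ) (h : ℝ) :
    MeasurableSet (halfOpenCube lo h) := by
  rw [halfOpenCube_eq_preimage]
  exact (PiLp.volume_preserving_ofLp (Fin M)).measurable
    (MeasurableSet.univ_pi fun _ => measurableSet_Ico)

theorem volume_halfOpenCube (lo : Fin M → ℝ) (h : ℝ) :
    volume (halfOpenCube lo h) = ENNReal.ofReal h ^ M := by
  rw [halfOpenCube_eq_preimage, (PiLp.volume_preserving_ofLp (Fin M)).measure_preimage
    (MeasurableSet.univ_pi fun _ => measurableSet_Ico).nullMeasurableSet, Real.volume_pi_Ico]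
  simp

theorem volume_real_halfOpenCube (lo : Fin M → ℝ) {h : ℝ} (hh : 0 ≤ h) :
    volume.real (halfOpenCube lo h) = h ^ M := by
  rw [measureReal_def, volume_halfOpenCube, ENNReal.toReal_pow, ENNReal.toReal_ofReal hh]

theorem convex_halfOpenCube (lo : Fin M → ℝ) (h : ℝ) : Convex ℝ (halfOpenCube lo h) := by
  rw [halfOpenCube_eq_preimage]
  exact (convex_pi fun i _ => convex_Ico _ _).linear_preimage
    (WithLp.linearEquiv 2 ℝ (Fin M → ℝ)).toLinearMap

theorem exists_halfOpenCube_subset {W : Set (EuclideanSpace ℝ (Fin M))}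
    (hW : (interior W).Nonempty) :
    ∃ (a : Fin M → ℝ) (s : ℝ), 0 < s ∧ halfOpenCube a s ⊆ W := by
  obtain ⟨c, hc⟩ := hW
  have hc' : W ∈ 𝓝 (WithLp.toLp 2 c.ofLp) := mem_interior_iff_mem_nhds.1 hc
  have h1 := (PiLp.continuous_toLp 2 (fun _ : Fin M => ℝ)).continuousAt (x := c.ofLp) hc'
  obtain ⟨s, hs, hsub⟩ := Metric.mem_nhds_iff.1 h1
  refine ⟨c.ofLp, s, hs, fun x hx => ?_⟩
  have : x.ofLp ∈ Metric.ball c.ofLp s := by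
    rw [Metric.mem_ball, dist_pi_lt_iff hs]
    intro i
    have := hx i
    rw [Real.dist_eq, abs_lt]
    constructor <;> linarith
  exact hsub this

/-- The cell with index `v` in the subdivision of `halfOpenCube a s` into `L ^ M` equal cubes. -/
def gridCell (a : Fin M → ℝ) (s : ℝ) (L : ℕ) (v : Fin M → Fin L) :
    Set (EuclideanSpace ℝ (Fin M)) :=
  halfOpenCube (fun i => a i + s / L * (v i : ℕ)) (s / L)

variable {a : Fin M → ℝ} {s : ℝ} {L : ℕ}

theorem convex_gridCell (v : Fin M → Fin L) : Convex ℝ (gridCell a s L v) :=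
  convex_halfOpenCube _ _

theorem nonempty_gridCell (hs : 0 < s) (v : Fin M → Fin L) : (gridCell a s L v).Nonempty := by
  refine ⟨WithLp.toLp 2 fun i => a i + s / L * (v i : ℕ), fun i => ?_⟩
  have hL : (0 : ℝ) < L := by exact_mod_cast (v i).pos
  have h4 : 0 < s / L := by positivity
  exact ⟨le_rfl, by simpa using h4⟩

theorem gridCell_subset (hs : 0 < s) (v : Fin M → Fin L) :
    gridCell a s L v ⊆ halfOpenCube a s := by
  intro x hx i
  have hL : (0 : ℝ) < L := by exact_mod_cast (v i).pos
  obtain ⟨h1, h2⟩ := hx i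
  have h3 : ((v i : ℕ) : ℝ) + 1 ≤ L := by exact_mod_cast (v i).isLt
  have h4 : 0 < s / L := by positivity
  have h5 : s / L * ((v i : ℕ) + 1) ≤ s := by
    calc s / L * ((v i : ℕ) + 1) ≤ s / L * L := by gcongr
      _ = s := by field_simp
  have h6 : 0 ≤ s / L * ((v i : ℕ) : ℝ) := by positivity
  constructor <;> linarith

theorem pairwise_disjoint_gridCell (hs : 0 < s) :
    Pairwise (Function.onFun Disjoint (gridCell a s L)) := by
  intro v w hvw
  refine Set.disjoint_left.2 fun x hx hy => hvw (funext fun i => Fin.ext ?_)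
  have hL : (0 : ℝ) < L := by exact_mod_cast (v i).pos
  have h4 : 0 < s / L := by positivity
  obtain ⟨h1, h2⟩ := hx i
  obtain ⟨h1', h2'⟩ := hy i
  have e1 : s / L * (v i : ℕ) < s / L * ((w i : ℕ) + 1) := by linarith
  have e2 : s / L * (w i : ℕ) < s / L * ((v i : ℕ) + 1) := by linarith
  have e1' : (v i : ℕ) < (w i : ℕ) + 1 := by exact_mod_cast lt_of_mul_lt_mul_left e1 h4.le
  have e2' : (w i : ℕ) < (v i : ℕ) + 1 := by exact_mod_cast lt_of_mul_lt_mul_left e2 h4.le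
  omega

/-- Cells that are at most `J` apart in each coordinate have their convex hull covered by `J + 1`
cubes of three times the side length, placed at equal distances along the segment that joins the
corners. -/
theorem convexHull_gridCell_union_subset (hs : 0 < s) {J : ℕ} (hJ : 0 < J)
    {v w : Fin M → Fin L} (hvw : ∀ i, |((v i : ℕ) : ℝ) - (w i : ℕ)| ≤ J) :
    convexHull ℝ (gridCell a s L v ∪ gridCell a s L w) ⊆
      ⋃ k : Fin (J + 1), halfOpenCube (fun i => a i + s / L * (v i : ℕ) +
        (k : ℕ) / J * (s / L * ((w i : ℕ) - (v i : ℕ))) - s / L) (3 * (s / L)) := by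
  intro x hx
  rw [(convex_gridCell v).convexHull_union (convex_gridCell w) (nonempty_gridCell hs v)
    (nonempty_gridCell hs w), mem_convexJoin] at hx
  obtain ⟨y, hy, z, hz, t', t, ht', ht, htt, rfl⟩ := hx
  have hJ' : (0 : ℝ) < J := by exact_mod_cast hJ
  have ht1 : t ≤ 1 := by linarith
  have hk : ⌊t * J⌋₊ ≤ J := Nat.floor_le_of_le (by nlinarith)
  have hk1 : (⌊t * J⌋₊ : ℝ) ≤ t * J := Nat.floor_le (by positivity)
  have hk2 : t * J < ⌊t * J⌋₊ + 1 := Nat.lt_floor_add_one _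
  refine Set.mem_iUnion.2 ⟨⟨⌊t * J⌋₊, Nat.lt_succ_of_le hk⟩, fun i => ?_⟩
  have hL : (0 : ℝ) < L := by exact_mod_cast (v i).pos
  have h4 : 0 < s / L := by positivity
  obtain ⟨y1, y2⟩ := hy i
  obtain ⟨z1, z2⟩ := hz i
  set c : ℝ := s / L with hc
  set d : ℝ := ((w i : ℕ) : ℝ) - (v i : ℕ) with hd
  have hdJ : |d| ≤ J := by rw [hd, abs_sub_comm]; exact hvw i
  set e : ℝ := t - (⌊t * J⌋₊ : ℝ) / J with he
  have hdiv : (⌊t * J⌋₊ : ℝ) / J = t - e := by rw [he]; ring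
  have heJ : e * J = t * J - ⌊t * J⌋₊ := by rw [he]; field_simp
  have he0 : 0 ≤ e * J := by linarith
  have he1 : e * J < 1 := by linarith
  have he0' : 0 ≤ e := nonneg_of_mul_nonneg_left he0 hJ'
  have hed : |e * d| < 1 := by
    rw [abs_mul, abs_of_nonneg he0']
    exact (mul_le_mul_of_nonneg_left hdJ he0').trans_lt he1
  obtain ⟨hed1, hed2⟩ := abs_lt.1 hed
  have hcd1 : -c ≤ c * (e * d) := by nlinarith
  have hcd2 : c * (e * d) < c := by nlinarith
  have hw' : ((w i : ℕ) : ℝ) = (v i : ℕ) + d := by rw [hd]; ring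
  have ht'' : t' = 1 - t := by linarith
  have hx : (t' • y + t • z) i = (1 - t) * y i + t * z i := by simp [ht'']
  rw [hx]
  have hwv : ((w i : ℕ) : ℝ) - (v i : ℕ) = d := hd.symm
  simp only [hdiv, hwv]
  simp only [hw'] at y1 y2 z1 z2
  have p1 := mul_le_mul_of_nonneg_left y1 (ht''.symm ▸ ht' : (0 : ℝ) ≤ 1 - t)
  have p2 := mul_le_mul_of_nonneg_left z1 ht
  have p3 := mul_le_mul_of_nonneg_left y2.le (ht''.symm ▸ ht' : (0 : ℝ) ≤ 1 - t)
  have p4 := mul_le_mul_of_nonneg_left z2.le ht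
  constructor
  · linear_combination p1 + p2 + hcd1
  · linear_combination p3 + p4 + hcd2

/-- In a convex body with its uniform distribution there are, for every `L`, disjoint cells
`Q v` of equal probability `q₀ / L ^ M`, indexed by a discrete cube of side `L`, such that the
convex hull of two cells at distance at most `J` in the index cube has probability
`O(J / L ^ M)`. -/
theorem exists_cells {W : Set (EuclideanSpace ℝ (Fin M))} (hW : IsCompact W)
    (hW_int : (interior W).Nonempty) :
    ∃ q₀ : ℝ, 0 < q₀ ∧ ∀ L : ℕ, 0 < L →
      ∃ Q : (Fin M → Fin L) → Set (EuclideanSpace ℝ (Fin M)),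
        (∀ v, MeasurableSet (Q v)) ∧ Pairwise (Function.onFun Disjoint Q) ∧
        (∀ v, (cond volume W).real (Q v) = q₀ / (L : ℝ) ^ M) ∧
        ∀ J : ℕ, 0 < J → ∀ v w : Fin M → Fin L, (∀ i, |((v i : ℕ) : ℝ) - (w i : ℕ)| ≤ J) →
          ∃ H, MeasurableSet H ∧ convexHull ℝ (Q v ∪ Q w) ⊆ H ∧
            (cond volume W).real H ≤ (J + 1) * 3 ^ M * (q₀ / (L : ℝ) ^ M) := by
  obtain ⟨a, s, hs, hsub⟩ := exists_halfOpenCube_subset hW_int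
  have hWm : MeasurableSet W := hW.measurableSet
  have hfin : volume W ≠ ⊤ := hW.measure_lt_top.ne
  have hpos : 0 < volume.real W := by
    have : 0 < volume W := (isOpen_interior.measure_pos volume hW_int).trans_le
      (measure_mono interior_subset)
    exact ENNReal.toReal_pos this.ne' hfin
  have hreal : ∀ A, (cond volume W).real A = volume.real (W ∩ A) / volume.real W := by
    intro A
    rw [measureReal_def, cond_apply hWm, ENNReal.toReal_mul, ENNReal.toReal_inv, ← measureReal_def,
      ← measureReal_def]
    field_simp
  refine ⟨s ^ M / volume.real W, by positivity, fun L hL => ⟨gridCell a s L,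
    fun v => measurableSet_halfOpenCube _ _, pairwise_disjoint_gridCell hs, fun v => ?_,
    fun J hJ v w hvw => ⟨_, ?_, convexHull_gridCell_union_subset hs hJ hvw, ?_⟩⟩⟩
  · rw [hreal, Set.inter_eq_right.2 ((gridCell_subset hs v).trans hsub), gridCell,
      volume_real_halfOpenCube _ (by positivity), div_pow]
    field_simp
  · exact MeasurableSet.iUnion fun _ => measurableSet_halfOpenCube _ _
  · rw [hreal]
    have hle := (measureReal_mono (μ := volume) (Set.inter_subset_right (s := W)
      (t := ⋃ k : Fin (J + 1), halfOpenCube (fun i => a i + s / L * (v i : ℕ) +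
        (k : ℕ) / J * (s / L * ((w i : ℕ) - (v i : ℕ))) - s / L) (3 * (s / L))))
      (by
        refine ((measure_iUnion_le _).trans_lt ?_).ne
        simp [volume_halfOpenCube, tsum_fintype, ENNReal.mul_lt_top_iff])).trans
      (measureReal_iUnion_fintype_le _)
    rw [Finset.sum_congr rfl fun k _ =>
      volume_real_halfOpenCube (M := M) _ (by positivity : 0 ≤ 3 * (s / (L : ℝ)))] at hle
    rw [div_le_iff₀ hpos]
    refine hle.trans (le_of_eq ?_)
    simp only [Finset.sum_const, Finset.card_univ, Fintype.card_fin, nsmul_eq_mul, mul_pow, div_pow]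
    push_cast
    field_simp

end Grid

/-! ### The degree in terms of indices -/

section IndexDegree

variable {M n : ℕ}

/-- The sample point with index `j` spans an empty simplex with the points indexed by `I`. -/
def IsEmptyApex (x : Fin n → EuclideanSpace ℝ (Fin M)) (I : Finset (Fin n)) (j : Fin n) : Prop :=
  j ∉ I ∧ ∀ l, l ∉ I → l ≠ j →
    x l ∉ convexHull ℝ (insert (x j) (x '' (I : Set (Fin n))))

open Classical in
/-- The analogue of `subsetDegree` for a set `I` of indices. -/
noncomputable def indexDegree (x : Fin n → EuclideanSpace ℝ (Fin M)) (I : Finset (Fin n)) : ℕ :=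
  (Finset.univ.filter (IsEmptyApex x I)).card

/-- The analogue of `maxDegree` for sets of indices. It is the degree of the sample whenever
the sample points are distinct. -/
noncomputable def indexMaxDegree (x : Fin n → EuclideanSpace ℝ (Fin M)) : ℕ :=
  ((Finset.univ : Finset (Fin n)).powersetCard M).sup (indexDegree x)

theorem indexDegree_le_indexMaxDegree (x : Fin n → EuclideanSpace ℝ (Fin M))
    {I : Finset (Fin n)} (hI : I.card = M) : indexDegree x I ≤ indexMaxDegree x :=
  Finset.le_sup (f := indexDegree x) (Finset.mem_powersetCard.2 ⟨Finset.subset_univ I, hI⟩)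

theorem indexMaxDegree_le (x : Fin n → EuclideanSpace ℝ (Fin M)) : indexMaxDegree x ≤ n :=
  Finset.sup_le fun _ _ => (Finset.card_le_univ _).trans_eq (Fintype.card_fin n)

theorem subsetDegree_map_eq_indexDegree (f : Fin n ↪ EuclideanSpace ℝ (Fin M))
    (I : Finset (Fin n)) :
    subsetDegree (Finset.univ.map f) (I.map f) = indexDegree f I := by
  classical
  rw [subsetDegree, indexDegree, ← Set.ncard_coe_finset, ← Set.ncard_image_of_injective _ f.injective]
  congr 1
  ext z
  simp only [Set.mem_ofPred_eq, Finset.mem_map, Finset.mem_univ, true_and, Set.mem_image,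
    Finset.coe_filter, Finset.coe_map, Finset.coe_univ, Set.image_univ]
  constructor
  · rintro ⟨⟨j, rfl⟩, hj, h⟩
    have hjI : j ∉ I := fun hjI => hj ⟨j, hjI, rfl⟩
    refine ⟨j, ⟨hjI, fun l hl hlj hmem => ?_⟩, rfl⟩
    have h2 : f l ∈ insert (f j) (f '' (I : Set (Fin n))) := h ▸ ⟨hmem, l, rfl⟩
    rcases h2 with h2 | ⟨i, hi, h2⟩
    · exact hlj (f.injective h2)
    · exact hl (f.injective h2 ▸ hi)
  · rintro ⟨j, ⟨hjI, hj⟩, rfl⟩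
    refine ⟨⟨j, rfl⟩, ?_, Set.Subset.antisymm ?_ ?_⟩
    · rintro ⟨i, hi, hij⟩
      exact hjI (f.injective hij ▸ hi)
    · rintro _ ⟨hmem, l, rfl⟩
      by_cases hlj : l = j
      · exact Or.inl (by rw [hlj])
      · by_contra hcon
        exact hj l (fun hl => hcon (Or.inr ⟨l, hl, rfl⟩)) hlj hmem
    · refine fun y hy => ⟨subset_convexHull ℝ _ hy, ?_⟩
      rcases hy with rfl | ⟨i, -, rfl⟩
      exacts [⟨j, rfl⟩, ⟨i, rfl⟩]

theorem maxDegree_sampleSet {x : Fin n → EuclideanSpace ℝ (Fin M)} (hx : Function.Injective x) :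
    maxDegree (sampleSet x) = indexMaxDegree x := by
  classical
  have h : sampleSet x = Finset.univ.map ⟨x, hx⟩ := by
    rw [Finset.map_eq_image]
    rfl
  rw [h, maxDegree, indexMaxDegree, Finset.powersetCard_map, Finset.sup_map]
  exact Finset.sup_congr rfl fun I _ => subsetDegree_map_eq_indexDegree ⟨x, hx⟩ I

/-- The convex hull of the points `x i`, `i ∈ T`, is the image of a fixed compact set under a
linear map that depends continuously on `x`. -/
theorem isClosed_setOf_mem_convexHull_image (T : Set (Fin n)) (l : Fin n) :
    IsClosed {x : Fin n → EuclideanSpace ℝ (Fin M) | x l ∈ convexHull ℝ (x '' T)} := by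
  set K : Set (Fin n → ℝ) := convexHull ℝ ((fun i => Pi.single i (1 : ℝ)) '' T)
  have hK : IsCompact K := (T.toFinite.image _).isCompact_convexHull ℝ
  have hconv : ∀ x : Fin n → EuclideanSpace ℝ (Fin M),
      convexHull ℝ (x '' T) = (fun w : Fin n → ℝ => ∑ i, w i • x i) '' K := by
    intro x
    have h := (Fintype.linearCombination ℝ x).image_convexHull
      ((fun i => Pi.single i (1 : ℝ)) '' T)
    rw [Set.image_image] at h
    simp only [Fintype.linearCombination_apply_single, one_smul] at h
    rw [← h]
    rfl
  have hset : {x : Fin n → EuclideanSpace ℝ (Fin M) | x l ∈ convexHull ℝ (x '' T)} =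
      Prod.snd '' {p : K × (Fin n → EuclideanSpace ℝ (Fin M)) |
        ∑ i, (p.1 : Fin n → ℝ) i • p.2 i = p.2 l} := by
    ext x
    simp only [Set.mem_ofPred_eq, hconv, Set.mem_image, Prod.exists, exists_eq_right,
      Subtype.exists, exists_prop]
  have : CompactSpace K := isCompact_iff_compactSpace.1 hK
  rw [hset]
  refine isClosedMap_snd_of_compactSpace _ (isClosed_eq ?_ (by fun_prop))
  exact continuous_finsetSum _ fun i _ =>
    ((continuous_apply i).comp (continuous_subtype_val.comp continuous_fst)).smul
      ((continuous_apply i).comp continuous_snd)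

theorem measurableSet_isEmptyApex (I : Finset (Fin n)) (j : Fin n) :
    MeasurableSet {x : Fin n → EuclideanSpace ℝ (Fin M) | IsEmptyApex x I j} := by
  have h : ∀ l, MeasurableSet {x : Fin n → EuclideanSpace ℝ (Fin M) |
      x l ∉ convexHull ℝ (insert (x j) (x '' (I : Set (Fin n))))} := by
    intro l
    have := (isClosed_setOf_mem_convexHull_image (M := M) (insert j (I : Set (Fin n)))
      l).measurableSet
    simp only [Set.image_insert_eq] at this
    exact this.compl
  have hset : {x : Fin n → EuclideanSpace ℝ (Fin M) | IsEmptyApex x I j} =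
      {_x | j ∉ I} ∩ ⋂ l, {x | l ∉ I → l ≠ j →
        x l ∉ convexHull ℝ (insert (x j) (x '' (I : Set (Fin n))))} := by
    ext x
    simp [IsEmptyApex]
  rw [hset]
  refine (MeasurableSet.const _).inter (MeasurableSet.iInter fun l => ?_)
  by_cases h1 : l ∈ I
  · simp [h1]
  · by_cases h2 : l = j
    · simp [h2]
    · simpa [h1, h2] using h l

theorem measurable_indexDegree (I : Finset (Fin n)) :
    Measurable fun x : Fin n → EuclideanSpace ℝ (Fin M) => indexDegree x I := by
  classical
  simp only [indexDegree, Finset.card_filter]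
  exact Finset.measurable_fun_sum _ fun j _ =>
    Measurable.ite (measurableSet_isEmptyApex I j) measurable_const measurable_const

theorem measurable_indexMaxDegree :
    Measurable fun x : Fin n → EuclideanSpace ℝ (Fin M) => indexMaxDegree x := by
  refine measurable_of_Iic fun m => ?_
  have h : (fun x : Fin n → EuclideanSpace ℝ (Fin M) => indexMaxDegree x) ⁻¹' Set.Iic m =
      ⋂ I ∈ (Finset.univ : Finset (Fin n)).powersetCard M, {x | indexDegree x I ≤ m} := by
    ext x
    simp [indexMaxDegree]
  rw [h]
  exact Finset.measurableSet_biInter _ fun I _ => measurable_indexDegree I measurableSet_Iic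

theorem ae_injective_pi {E : Type*} [MeasurableSpace E] 
    [MeasurableEq E] (μ : Measure E) [IsProbabilityMeasure μ] [NullSingletonClass μ] :
    ∀ᵐ x ∂(Measure.pi fun _ : Fin n => μ), Function.Injective x := by
  have hij : ∀ i j : Fin n, i ≠ j → ∀ᵐ x ∂(Measure.pi fun _ : Fin n => μ), x i ≠ x j := by
    intro i j hne
    have hind : IndepFun (fun x : Fin n → E => x i) (fun x => x j)
        (Measure.pi fun _ => μ) := (iIndepFun_pi (μ := fun _ : Fin n => μ) (X := fun _ => id)
      fun _ => aemeasurable_id).indepFun hne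
    rw [indepFun_iff_map_prod_eq_prod_map_map (measurable_pi_apply i).aemeasurable
      (measurable_pi_apply j).aemeasurable] at hind
    have hmi : ∀ i : Fin n, (Measure.pi fun _ : Fin n => μ).map (fun x => x i) = μ :=
      fun i => (measurePreserving_eval (fun _ : Fin n => μ) i).map_eq
    rw [hmi, hmi] at hind
    have hdiag : (μ.prod μ) (Set.diagonal E) = 0 := by
      rw [Measure.measure_prod_null MeasurableEq.measurableSet_diagonal]
      refine Filter.Eventually.of_forall fun y => ?_
      have : Prod.mk y ⁻¹' Set.diagonal E = {y} := by
        ext z; simp [eq_comm]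
      simp [this]
    rw [← hind, Measure.map_apply ((measurable_pi_apply i).prodMk (measurable_pi_apply j))
      MeasurableEq.measurableSet_diagonal] at hdiag
    rw [ae_iff]
    simp only [ne_eq, not_not]
    exact hdiag
  have hall : ∀ᵐ x ∂(Measure.pi fun _ : Fin n => μ), ∀ i j : Fin n, i ≠ j → x i ≠ x j := by
    simp only [ae_all_iff]
    exact fun i j hne => hij i j hne
  filter_upwards [hall] with x hx i j h
  by_contra hne
  exact hx i j hne h

end IndexDegree

/-! ### Second moment of the degree -/

section SecondMoment

theorem sq_integral_mul_le {Ω : Type*} [MeasurableSpace Ω] {P : Measure Ω} {f g : Ω → ℝ}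
    (hf : Integrable (fun x => f x ^ 2) P) (hg : Integrable (fun x => g x ^ 2) P)
    (hfg : Integrable (fun x => f x * g x) P) :
    (∫ x, f x * g x ∂P) ^ 2 ≤ (∫ x, f x ^ 2 ∂P) * ∫ x, g x ^ 2 ∂P := by
  have h : ∀ t : ℝ, 0 ≤ (∫ x, f x ^ 2 ∂P) * (t * t) + (2 * ∫ x, f x * g x ∂P) * t +
      ∫ x, g x ^ 2 ∂P := by
    intro t
    have h1 : ∫ x, (t * f x + g x) ^ 2 ∂P = (∫ x, f x ^ 2 ∂P) * (t * t) +
        (2 * ∫ x, f x * g x ∂P) * t + ∫ x, g x ^ 2 ∂P := by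
      have : ∀ x, (t * f x + g x) ^ 2 = (t * t) * f x ^ 2 + (2 * t) * (f x * g x) + g x ^ 2 :=
        fun x => by ring
      simp only [this]
      have i1 : Integrable (fun x => (t * t) * f x ^ 2) P := hf.const_mul _
      have i2 : Integrable (fun x => (2 * t) * (f x * g x)) P := hfg.const_mul _
      have i12 : Integrable (fun x => (t * t) * f x ^ 2 + (2 * t) * (f x * g x)) P := i1.add i2
      rw [integral_add i12 hg, integral_add i1 i2, integral_const_mul, integral_const_mul]
      ring
    rw [← h1]
    exact integral_nonneg fun x => sq_nonneg _
  have := discrim_le_zero h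
  rw [discrim] at this
  linarith

variable {M n : ℕ} {μ : Measure (EuclideanSpace ℝ (Fin M))} [IsProbabilityMeasure μ]
  {κ : Type*} [Fintype κ] {Q : κ → Set (EuclideanSpace ℝ (Fin M))}
  {H : κ → κ → Set (EuclideanSpace ℝ (Fin M))} {q h : ℝ}

/-- If the points of `I` lie in `Q v`, the point `x j` in `Q w` and no other sample point in
`H v w`, then `x j` spans an empty simplex with the points of `I`. -/
theorem le_pi_real_clusterEvent_inter_isEmptyApex (hM : 0 < M) (hQ : ∀ v, MeasurableSet (Q v))
    (hdisj : Pairwise (Function.onFun Disjoint Q)) (hq : ∀ v, μ.real (Q v) = q) (hq0 : 0 ≤ q)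
    (hH : ∀ v w, MeasurableSet (H v w)) (hconv : ∀ v w, convexHull ℝ (Q v ∪ Q w) ⊆ H v w)
    (hh : ∀ v w, μ.real (H v w) ≤ h) (h0 : 0 ≤ h) (h1 : h ≤ 1)
    {I : Finset (Fin n)} (hI : I.card = M) {j : Fin n} (hj : j ∉ I) :
    (Fintype.card κ * q ^ M) * (Fintype.card κ * q * (1 - h) ^ n) ≤
      (Measure.pi fun _ : Fin n => μ).real (clusterEvent Q I ∩ {x | IsEmptyApex x I j}) := by
  classical
  set F : κ × κ → Fin n → Set (EuclideanSpace ℝ (Fin M)) := fun v i =>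
    if i ∈ I then Q v.1 else if i = j then Q v.2 else (H v.1 v.2)ᶜ with hF
  have hFm : ∀ v i, MeasurableSet (F v i) := by
    intro v i
    simp only [hF]
    split_ifs
    exacts [hQ _, hQ _, (hH _ _).compl]
  set G : κ × κ → Set (Fin n → EuclideanSpace ℝ (Fin M)) := fun v =>
    {x | ∀ i ∈ Finset.univ, x i ∈ F v i} with hG
  have hGI : ∀ v x, x ∈ G v → ∀ i ∈ I, x i ∈ Q v.1 := by
    intro v x hx i hi
    have := hx i (Finset.mem_univ i)
    simpa only [hF, if_pos hi] using this
  have hGj : ∀ v x, x ∈ G v → x j ∈ Q v.2 := by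
    intro v x hx
    have := hx j (Finset.mem_univ j)
    simpa only [hF, if_neg hj, if_true] using this
  have hGl : ∀ v x, x ∈ G v → ∀ l, l ∉ I → l ≠ j → x l ∉ H v.1 v.2 := by
    intro v x hx l hl hlj
    have := hx l (Finset.mem_univ l)
    simp only [hF, if_neg hl, if_neg hlj] at this
    exact this
  have hsub : (⋃ v, G v) ⊆ clusterEvent Q I ∩ {x | IsEmptyApex x I j} := by
    intro x hx
    obtain ⟨v, hv⟩ := Set.mem_iUnion.1 hx
    refine ⟨⟨v.1, hGI v x hv⟩, hj, fun l hl hlj hmem => hGl v x hv l hl hlj (hconv _ _ ?_)⟩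
    refine convexHull_mono ?_ hmem
    rintro y (rfl | ⟨i, hi, rfl⟩)
    exacts [Or.inr (hGj v x hv), Or.inl (hGI v x hv i hi)]
  obtain ⟨i₀, hi₀⟩ : I.Nonempty := Finset.card_pos.1 (by omega)
  have hGd : Pairwise (Function.onFun Disjoint G) := by
    intro v w hvw
    refine Set.disjoint_left.2 fun x hx hy => hvw (Prod.ext ?_ ?_)
    · by_contra hne
      exact Set.disjoint_left.1 (hdisj hne) (hGI v x hx i₀ hi₀) (hGI w x hy i₀ hi₀)
    · by_contra hne
      exact Set.disjoint_left.1 (hdisj hne) (hGj v x hx) (hGj w x hy)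
  have hGle : ∀ v, q ^ M * q * (1 - h) ^ n ≤ (Measure.pi fun _ : Fin n => μ).real (G v) := by
    intro v
    rw [hG, pi_real_forall_mem]
    calc q ^ M * q * (1 - h) ^ n
        = ∏ i : Fin n, ((if i ∈ I then q else 1) * (if i = j then q else 1) * (1 - h)) := by
          rw [Finset.prod_mul_distrib, Finset.prod_mul_distrib, Finset.prod_ite_mem,
            Finset.univ_inter, Finset.prod_ite_eq']
          simp [hI]
      _ ≤ _ := by
          refine Finset.prod_le_prod (fun i _ => ?_) fun i _ => ?_
          · have : 0 ≤ 1 - h := by linarith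
            split_ifs <;> positivity
          · by_cases hi : i ∈ I
            · have hij : i ≠ j := fun e => hj (e ▸ hi)
              simp only [hF, if_pos hi, if_neg hij, hq]
              nlinarith
            · by_cases hij : i = j
              · simp only [hF, if_neg hi, if_pos hij, hq]
                nlinarith
              · simp only [hF, if_neg hi, if_neg hij, probReal_compl_eq_one_sub (hH _ _)]
                linarith [hh v.1 v.2]
  refine le_trans ?_ (measureReal_mono hsub)
  rw [measureReal_iUnion_fintype hGd fun v => measurableSet_forall_mem _ (hFm v)]
  calc _ = ∑ _v : κ × κ, q ^ M * q * (1 - h) ^ n := by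
        simp only [Finset.sum_const, Finset.card_univ, Fintype.card_prod, nsmul_eq_mul]
        push_cast
        ring
    _ ≤ _ := Finset.sum_le_sum fun v _ => hGle v

/-- The sum of the degrees of all clusters, written with indicators, is at most the number of
clusters times the maximal degree. -/
theorem sum_indicator_mul_indexDegree_le {ι : Type*} (Q : ι → Set (EuclideanSpace ℝ (Fin M)))
    (x : Fin n → EuclideanSpace ℝ (Fin M)) :
    ∑ I ∈ (Finset.univ : Finset (Fin n)).powersetCard M, ∑ j,
      (clusterEvent Q I ∩ {x | IsEmptyApex x I j}).indicator (1 : (Fin n → EuclideanSpace ℝ (Fin M)) → ℝ) x ≤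
    clusterCount Q M x * indexMaxDegree x := by
  classical
  rw [clusterCount, Finset.sum_mul]
  refine Finset.sum_le_sum fun I hI => ?_
  have h1 : ∀ j, (clusterEvent Q I ∩ {x | IsEmptyApex x I j}).indicator (1 : (Fin n → EuclideanSpace ℝ (Fin M)) → ℝ) x =
      (clusterEvent Q I).indicator 1 x * if IsEmptyApex x I j then 1 else 0 := by
    intro j
    rw [Set.inter_indicator_one, Pi.mul_apply]
    rfl
  simp only [h1, ← Finset.mul_sum]
  refine mul_le_mul_of_nonneg_left ?_ (Set.indicator_nonneg (fun _ _ => zero_le_one) _)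
  have := indexDegree_le_indexMaxDegree x (Finset.mem_powersetCard.1 hI).2
  rw [indexDegree, Finset.card_filter] at this
  exact_mod_cast this

theorem integrable_of_indexMaxDegree (F : ℕ → ℝ) :
    Integrable (fun x : Fin n → EuclideanSpace ℝ (Fin M) => F (indexMaxDegree x))
      (Measure.pi fun _ : Fin n => μ) := by
  refine Integrable.of_bound (C := ∑ i ∈ Finset.range (n + 1), ‖F i‖)
    ((measurable_from_nat (f := F)).comp measurable_indexMaxDegree).aestronglyMeasurable
    (Filter.Eventually.of_forall fun x => ?_)
  exact Finset.single_le_sum (f := fun i => ‖F i‖) (fun _ _ => norm_nonneg _)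
    (Finset.mem_range.2 (Nat.lt_succ_of_le (indexMaxDegree_le x)))

/-- Lower bound for the second moment of the degree: Cauchy-Schwarz for the product of the number
of clusters with the degree, which dominates the sum of the degrees of the clusters. -/
theorem sq_le_integral_indexMaxDegree_sq (hM : 0 < M) (hQ : ∀ v, MeasurableSet (Q v))
    (hdisj : Pairwise (Function.onFun Disjoint Q)) (hq : ∀ v, μ.real (Q v) = q) (hq0 : 0 ≤ q)
    (hH : ∀ v w, MeasurableSet (H v w)) (hconv : ∀ v w, convexHull ℝ (Q v ∪ Q w) ⊆ H v w)
    (hh : ∀ v w, μ.real (H v w) ≤ h) (h0 : 0 ≤ h) (h1 : h ≤ 1) (hMn : M ≤ n) {b : ℝ}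
    (hb : b = n.choose M * (Fintype.card κ * q ^ M)) :
    (b * ((n - M) * (Fintype.card κ * q * (1 - h) ^ n))) ^ 2 ≤
      (b ^ 2 + b * (2 ^ M * (1 + q) ^ n)) *
        ∫ x, (indexMaxDegree x : ℝ) ^ 2 ∂(Measure.pi fun _ : Fin n => μ) := by
  classical
  set P := Measure.pi fun _ : Fin n => μ
  have h1h : 0 ≤ 1 - h := by linarith
  have hms : ∀ (I : Finset (Fin n)) (j : Fin n),
      MeasurableSet (clusterEvent Q I ∩ {x | IsEmptyApex x I j}) := fun I j =>
    (measurableSet_clusterEvent hQ I).inter (measurableSet_isEmptyApex I j)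
  have hNg : Integrable (fun x => clusterCount Q M x * (indexMaxDegree x : ℝ)) P :=
    (integrable_clusterCount hQ M).mul_bdd (c := n)
      (measurable_from_nat.comp measurable_indexMaxDegree).aestronglyMeasurable
      (Filter.Eventually.of_forall fun x => by
        simpa using indexMaxDegree_le x)
  have hmean : b * ((n - M) * (Fintype.card κ * q * (1 - h) ^ n)) ≤
      ∫ x, clusterCount Q M x * (indexMaxDegree x : ℝ) ∂P := by
    refine le_trans ?_ (integral_mono (integrable_finsetSum _ fun I _ =>
      integrable_finsetSum _ fun j _ => integrable_indicator_one P (hms I j)) hNg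
      fun x => sum_indicator_mul_indexDegree_le Q x)
    rw [integral_finsetSum _ fun I _ => integrable_finsetSum _ fun j _ =>
      integrable_indicator_one P (hms I j)]
    calc b * ((n - M) * (Fintype.card κ * q * (1 - h) ^ n))
        = ∑ I ∈ (Finset.univ : Finset (Fin n)).powersetCard M,
          (n - M) * ((Fintype.card κ * q ^ M) * (Fintype.card κ * q * (1 - h) ^ n)) := by
          rw [hb]
          simp
          ring
      _ ≤ _ := by
          refine Finset.sum_le_sum fun I hI => ?_
          have hc := (Finset.mem_powersetCard.1 hI).2
          rw [integral_finsetSum _ fun j _ => integrable_indicator_one P (hms I j)]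
          simp only [integral_indicator_one (hms I _)]
          calc _ = ∑ j ∈ Iᶜ, (Fintype.card κ * q ^ M) * (Fintype.card κ * q * (1 - h) ^ n) := by
                rw [Finset.sum_const, Finset.card_compl, hc, Fintype.card_fin, nsmul_eq_mul,
                  Nat.cast_sub hMn]
            _ ≤ ∑ j ∈ Iᶜ, P.real (clusterEvent Q I ∩ {x | IsEmptyApex x I j}) :=
                Finset.sum_le_sum fun j hj => le_pi_real_clusterEvent_inter_isEmptyApex hM hQ
                  hdisj hq hq0 hH hconv hh h0 h1 hc (Finset.mem_compl.1 hj)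
            _ ≤ _ := Finset.sum_le_sum_of_subset_of_nonneg (Finset.subset_univ _)
                fun _ _ _ => measureReal_nonneg
  have hnM : (0 : ℝ) ≤ n - M := by
    have : (M : ℝ) ≤ n := by exact_mod_cast hMn
    linarith
  have hb0 : 0 ≤ b := by rw [hb]; positivity
  calc _ ≤ (∫ x, clusterCount Q M x * (indexMaxDegree x : ℝ) ∂P) ^ 2 := by
        gcongr
    _ ≤ (∫ x, clusterCount Q M x ^ 2 ∂P) * ∫ x, (indexMaxDegree x : ℝ) ^ 2 ∂P :=
        sq_integral_mul_le (integrable_clusterCount_sq hQ M)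
          (integrable_of_indexMaxDegree fun m => (m : ℝ) ^ 2) hNg
    _ ≤ _ := by
        refine mul_le_mul_of_nonneg_right ?_ (integral_nonneg fun x => by positivity)
        rw [hb]
        exact integral_clusterCount_sq_le hQ hdisj hq hq0 M

end SecondMoment

/-! ### Choice of the grid size -/

section GridSize

theorem exists_pow_between {e t n : ℕ} (he : 0 < e) (ht : 0 < t) (hn : t ≤ n) :
    ∃ L : ℕ, 0 < L ∧ n ≤ t * L ^ e ∧ t * L ^ e ≤ 2 ^ e * n := by
  have hex : ∃ L, n ≤ t * L ^ e :=
    ⟨n, (Nat.le_self_pow he.ne' n).trans (Nat.le_mul_of_pos_left _ ht)⟩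
  classical
  have hspec := Nat.find_spec hex
  have hpos : 0 < Nat.find hex := by
    rcases Nat.eq_zero_or_pos (Nat.find hex) with h0 | h0
    · rw [h0, zero_pow he.ne', mul_zero] at hspec
      omega
    · exact h0
  refine ⟨Nat.find hex, hpos, hspec, ?_⟩
  obtain h1 | h2 : Nat.find hex = 1 ∨ 2 ≤ Nat.find hex := by omega
  · rw [h1, one_pow, mul_one]
    exact hn.trans (Nat.le_mul_of_pos_left _ (by positivity))
  · have hmin : t * (Nat.find hex - 1) ^ e < n :=
      not_le.1 (Nat.find_min hex (by omega))
    have hle : Nat.find hex ≤ 2 * (Nat.find hex - 1) := by omega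
    calc t * Nat.find hex ^ e ≤ t * (2 * (Nat.find hex - 1)) ^ e := by gcongr
      _ = 2 ^ e * (t * (Nat.find hex - 1) ^ e) := by ring
      _ ≤ 2 ^ e * n := by gcongr

variable {M n L t : ℕ} {q₀ : ℝ}

/-- The expected number of clusters of `M` points in a grid of `L ^ M` cells of probability
`q₀ / L ^ M`. -/
noncomputable def expectedClusters (M n L : ℕ) (q₀ : ℝ) : ℝ :=
  n.choose M * ((L : ℝ) ^ M * (q₀ / (L : ℝ) ^ M) ^ M)

theorem expectedClusters_eq (hM : 0 < M) (hL : 0 < L) :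
    expectedClusters M n L q₀ = n.choose M * (q₀ ^ M / ((L : ℝ) ^ (M - 1)) ^ M) := by
  have hL' : (0 : ℝ) < L := by exact_mod_cast hL
  obtain ⟨e, rfl⟩ : ∃ e, M = e + 1 := ⟨M - 1, by omega⟩
  rw [expectedClusters, Nat.add_sub_cancel, div_pow, pow_succ (L : ℝ) e, mul_pow ((L : ℝ) ^ e)]
  field_simp
  ring

theorem le_expectedClusters (hM : 0 < M) (hq₀ : 0 < q₀) (ht : 0 < t) (hL : 0 < L)
    (hLn : t * L ^ (M - 1) ≤ 2 ^ (M - 1) * n) (hMn : 2 * M ≤ n) :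
    q₀ ^ M / (M.factorial * (2 * 2 ^ (M - 1)) ^ M) * (t : ℝ) ^ M ≤ expectedClusters M n L q₀ := by
  have hL' : (0 : ℝ) < L := by exact_mod_cast hL
  have ht' : (0 : ℝ) < t := by exact_mod_cast ht
  have hn : (0 : ℝ) < n := by exact_mod_cast (by omega : 0 < n)
  have hch : ((n : ℝ) / 2) ^ M / M.factorial ≤ n.choose M := by
    refine le_trans ?_ (Nat.pow_le_choose M n)
    have : (n : ℝ) / 2 ≤ ((n + 1 - M : ℕ) : ℝ) := by
      rw [div_le_iff₀ two_pos]
      exact_mod_cast (by omega : n ≤ (n + 1 - M) * 2)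
    gcongr
  have hLn' : (t : ℝ) * (L : ℝ) ^ (M - 1) ≤ 2 ^ (M - 1) * n := by exact_mod_cast hLn
  have hLe : (L : ℝ) ^ (M - 1) ≤ 2 ^ (M - 1) * n / t := by
    rw [le_div_iff₀ ht']
    linarith
  rw [expectedClusters_eq hM hL]
  calc _ = ((n : ℝ) / 2) ^ M / M.factorial * (q₀ ^ M / (2 ^ (M - 1) * n / t) ^ M) := by
        simp only [div_pow, mul_pow]
        field_simp
    _ ≤ _ := by gcongr

theorem expectedClusters_le (hM : 0 < M) (hq₀ : 0 < q₀) (hL : 0 < L)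
    (hLn : n ≤ t * L ^ (M - 1)) : expectedClusters M n L q₀ ≤ q₀ ^ M * (t : ℝ) ^ M := by
  have hL' : (0 : ℝ) < L := by exact_mod_cast hL
  have hLn' : (n : ℝ) ≤ t * (L : ℝ) ^ (M - 1) := by exact_mod_cast hLn
  have hch : (n.choose M : ℝ) ≤ (n : ℝ) ^ M := by exact_mod_cast Nat.choose_le_pow n M
  rw [expectedClusters_eq hM hL]
  calc _ ≤ (t * (L : ℝ) ^ (M - 1)) ^ M * (q₀ ^ M / ((L : ℝ) ^ (M - 1)) ^ M) := by
        gcongr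
        exact hch.trans (by gcongr)
    _ = q₀ ^ M * (t : ℝ) ^ M := by
        rw [mul_pow]
        field_simp

theorem natCast_mul_cell_le (hM : 0 < M) (hq₀ : 0 < q₀) (hL : 0 < L)
    (hLn : n ≤ t * L ^ (M - 1)) : n * (q₀ / (L : ℝ) ^ M) ≤ t * q₀ / L := by
  have hL' : (0 : ℝ) < L := by exact_mod_cast hL
  have hLn' : (n : ℝ) ≤ t * (L : ℝ) ^ (M - 1) := by exact_mod_cast hLn
  calc (n : ℝ) * (q₀ / (L : ℝ) ^ M) ≤ t * (L : ℝ) ^ (M - 1) * (q₀ / (L : ℝ) ^ M) := by gcongr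
    _ = t * q₀ / L := by
      obtain ⟨e, rfl⟩ : ∃ e, M = e + 1 := ⟨M - 1, by omega⟩
      rw [Nat.add_sub_cancel, pow_succ]
      field_simp

theorem one_add_cell_pow_le (hM : 0 < M) (hq₀ : 0 < q₀) (hL : 0 < L) (htL : t ≤ L)
    (hLn : n ≤ t * L ^ (M - 1)) : (1 + q₀ / (L : ℝ) ^ M) ^ n ≤ Real.exp q₀ := by
  have hL' : (0 : ℝ) < L := by exact_mod_cast hL
  have htL' : (t : ℝ) ≤ L := by exact_mod_cast htL
  have h1 : 1 + q₀ / (L : ℝ) ^ M ≤ Real.exp (q₀ / (L : ℝ) ^ M) := by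
    linarith [Real.add_one_le_exp (q₀ / (L : ℝ) ^ M)]
  calc (1 + q₀ / (L : ℝ) ^ M) ^ n ≤ Real.exp (q₀ / (L : ℝ) ^ M) ^ n := by gcongr
    _ = Real.exp (n * (q₀ / (L : ℝ) ^ M)) := (Real.exp_nat_mul _ _).symm
    _ ≤ Real.exp q₀ := by
        refine Real.exp_le_exp.2 ((natCast_mul_cell_le hM hq₀ hL hLn).trans ?_)
        rw [div_le_iff₀ hL']
        nlinarith

end GridSize

/-! ### Linear growth of the moments -/

section Moments

theorem exp_neg_two_mul_le_one_sub {h : ℝ} (h0 : 0 ≤ h) (h1 : h ≤ 1 / 2) :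
    Real.exp (-(2 * h)) ≤ 1 - h := by
  have h2 : 1 + 2 * h ≤ Real.exp (2 * h) := by linarith [Real.add_one_le_exp (2 * h)]
  rw [Real.exp_neg, inv_le_comm₀ (Real.exp_pos _) (by linarith)]
  refine le_trans ?_ h2
  rw [inv_le_iff_one_le_mul₀ (by linarith)]
  nlinarith

variable {M : ℕ} {W : Set (EuclideanSpace ℝ (Fin M))}

/-- The second moment of the degree is of the largest possible order `n ^ 2`. -/
theorem exists_le_integral_indexMaxDegree_sq (hM : 2 ≤ M) (hW : IsCompact W)
    (hW_int : (interior W).Nonempty) [IsProbabilityMeasure (cond volume W)] :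
    ∃ c : ℝ, 0 < c ∧ ∃ N : ℕ, ∀ n, N ≤ n →
      c * (n : ℝ) ^ 2 ≤ ∫ x, (indexMaxDegree x : ℝ) ^ 2 ∂(uniformSampleLaw W n) := by
  obtain ⟨q₀, hq₀, hcells⟩ := exists_cells hW hW_int
  set C : ℝ := 2 * 3 ^ M * q₀ with hC
  have hC0 : 0 < C := by positivity
  set c₁ : ℝ := q₀ ^ M / (M.factorial * (2 * 2 ^ (M - 1)) ^ M) with hc₁
  have hc₁0 : 0 < c₁ := by positivity
  set d : ℝ := 2 ^ M * Real.exp q₀ with hd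
  have hd0 : 0 < d := by positivity
  refine ⟨c₁ / (c₁ + d) * (q₀ * Real.exp (-(2 * C)) / 2) ^ 2, by positivity,
    max (2 * M) ⌈2 * C⌉₊, fun n hn => ?_⟩
  have hMn : 2 * M ≤ n := (le_max_left _ _).trans hn
  have hCn : 2 * C ≤ n := (Nat.le_ceil _).trans (by exact_mod_cast (le_max_right _ _).trans hn)
  have hn0 : (0 : ℝ) < n := by exact_mod_cast (by omega : 0 < n)
  obtain ⟨L, hL, hnL, hLn⟩ := exists_pow_between (e := M - 1) (t := 1) (n := n) (by omega)
    one_pos (by omega)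
  have hL' : (0 : ℝ) < L := by exact_mod_cast hL
  obtain ⟨Q, hQ, hdisj, hq, hconv⟩ := hcells L hL
  have hLJ : ∀ v w : Fin M → Fin L, ∀ i, |((v i : ℕ) : ℝ) - (w i : ℕ)| ≤ L := by
    intro v w i
    have h1 : ((v i : ℕ) : ℝ) ≤ L := by exact_mod_cast (v i).isLt.le
    have h2 : ((w i : ℕ) : ℝ) ≤ L := by exact_mod_cast (w i).isLt.le
    rw [abs_le]
    constructor <;> linarith [Nat.cast_nonneg (α := ℝ) (v i : ℕ), Nat.cast_nonneg (α := ℝ) (w i : ℕ)]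
  choose H hHm hHc hHle using fun v w => hconv L hL v w (hLJ v w)
  have hh : ∀ v w, (cond volume W).real (H v w) ≤ C / n := by
    intro v w
    refine (hHle v w).trans ?_
    have h1 : ((n : ℕ) : ℝ) * (q₀ / (L : ℝ) ^ M) ≤ (1 : ℕ) * q₀ / L :=
      natCast_mul_cell_le (by omega) hq₀ hL hnL
    have hL1 : (1 : ℝ) ≤ L := by exact_mod_cast hL
    rw [le_div_iff₀ hn0]
    calc ((L : ℝ) + 1) * 3 ^ M * (q₀ / (L : ℝ) ^ M) * n
        = ((L : ℝ) + 1) * 3 ^ M * (n * (q₀ / (L : ℝ) ^ M)) := by ring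
      _ ≤ (L + L) * 3 ^ M * ((1 : ℕ) * q₀ / L) := by gcongr
      _ = C := by
        rw [hC, Nat.cast_one]
        field_simp
        ring
  have hhalf : C / n ≤ 1 / 2 := by
    rw [div_le_iff₀ hn0]
    linarith
  have hpow : Real.exp (-(2 * C)) ≤ (1 - C / n) ^ n := by
    have := pow_le_pow_left₀ (Real.exp_nonneg _)
      (exp_neg_two_mul_le_one_sub (by positivity : 0 ≤ C / n) hhalf) n
    rw [← Real.exp_nat_mul] at this
    have e1 : (n : ℝ) * -(2 * (C / n)) = -(2 * C) := by field_simp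
    rwa [e1] at this
  have hcard : (Fintype.card (Fin M → Fin L) : ℝ) = (L : ℝ) ^ M := by simp
  have hmain := sq_le_integral_indexMaxDegree_sq (n := n) (by omega) hQ hdisj hq (by positivity)
    hHm hHc hh (by positivity) (by linarith) (by omega) rfl
  rw [hcard, mul_div_cancel₀ _ (by positivity)] at hmain
  change (expectedClusters M n L q₀ * _) ^ 2 ≤ (expectedClusters M n L q₀ ^ 2 +
    expectedClusters M n L q₀ * _) * _ at hmain
  set b := expectedClusters M n L q₀
  have hb : c₁ ≤ b := by
    simpa using le_expectedClusters (t := 1) (by omega) hq₀ one_pos hL hLn hMn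
  have hb0 : 0 < b := hc₁0.trans_le hb
  have hd1 : 2 ^ M * (1 + q₀ / (L : ℝ) ^ M) ^ n ≤ d :=
    mul_le_mul_of_nonneg_left (one_add_cell_pow_le (by omega) hq₀ hL hL hnL) (by positivity)
  set S := ∫ x, (indexMaxDegree x : ℝ) ^ 2 ∂(uniformSampleLaw W n)
  have hS0 : 0 ≤ S := integral_nonneg fun x => by positivity
  set X : ℝ := (n - M) * (q₀ * (1 - C / n) ^ n) with hX
  have hX1 : q₀ * Real.exp (-(2 * C)) / 2 * n ≤ X := by
    have h2 : (n : ℝ) / 2 ≤ n - M := by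
      have : 2 * (M : ℝ) ≤ n := by exact_mod_cast hMn
      linarith
    calc q₀ * Real.exp (-(2 * C)) / 2 * n = n / 2 * (q₀ * Real.exp (-(2 * C))) := by ring
      _ ≤ X := by
        rw [hX]
        gcongr
        linarith
  have h3 : b * (b * X ^ 2) ≤ b * ((b + d) * S) := by
    calc b * (b * X ^ 2) = (b * X) ^ 2 := by ring
      _ ≤ (b ^ 2 + b * (2 ^ M * (1 + q₀ / (L : ℝ) ^ M) ^ n)) * S := hmain
      _ ≤ (b ^ 2 + b * d) * S := by gcongr
      _ = b * ((b + d) * S) := by ring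
  have h4 : b * X ^ 2 ≤ (b + d) * S := le_of_mul_le_mul_left h3 hb0
  have h5 : c₁ * X ^ 2 ≤ (c₁ + d) * S := by
    refine le_of_mul_le_mul_left ?_ hb0
    have e1 := mul_le_mul_of_nonneg_left h4 hc₁0.le
    have e2 : c₁ * (d * S) ≤ b * (d * S) := mul_le_mul_of_nonneg_right hb (by positivity)
    linarith
  calc c₁ / (c₁ + d) * (q₀ * Real.exp (-(2 * C)) / 2) ^ 2 * (n : ℝ) ^ 2
      = c₁ / (c₁ + d) * (q₀ * Real.exp (-(2 * C)) / 2 * n) ^ 2 := by ring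
    _ ≤ c₁ / (c₁ + d) * X ^ 2 := by gcongr
    _ ≤ S := by
      rw [div_mul_eq_mul_div, div_le_iff₀ (by positivity)]
      linarith

/-- All moments of the degree are of the largest possible order. The second moment bounds the
mean from below because the degree is at most `n`, and Jensen's inequality gives the rest. -/
theorem exists_le_integral_indexMaxDegree_pow (hM : 2 ≤ M) (hW : IsCompact W)
    (hW_int : (interior W).Nonempty) [IsProbabilityMeasure (cond volume W)] :
    ∃ c : ℝ, 0 < c ∧ ∃ N : ℕ, ∀ n, N ≤ n → ∀ k : ℕ,
      (c * n) ^ k ≤ ∫ x, (indexMaxDegree x : ℝ) ^ k ∂(uniformSampleLaw W n) := by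
  obtain ⟨c, hc, N, hN⟩ := exists_le_integral_indexMaxDegree_sq hM hW hW_int
  refine ⟨c, hc, max N 1, fun n hn k => ?_⟩
  have hn0 : (0 : ℝ) < n := by exact_mod_cast (le_max_right N 1).trans hn
  have hint : ∀ F : ℕ → ℝ, Integrable (fun x : Fin n → EuclideanSpace ℝ (Fin M) =>
      F (indexMaxDegree x)) (uniformSampleLaw W n) := integrable_of_indexMaxDegree
  have : IsProbabilityMeasure (uniformSampleLaw W n) := by
    unfold uniformSampleLaw; infer_instance
  have hmean : c * n ≤ ∫ x, (indexMaxDegree x : ℝ) ∂(uniformSampleLaw W n) := by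
    have h1 := hN n ((le_max_left _ _).trans hn)
    have h2 : ∫ x, (indexMaxDegree x : ℝ) ^ 2 ∂(uniformSampleLaw W n) ≤
        n * ∫ x, (indexMaxDegree x : ℝ) ∂(uniformSampleLaw W n) := by
      rw [← integral_const_mul]
      refine integral_mono (hint fun m => (m : ℝ) ^ 2) (hint fun m => n * (m : ℝ)) fun x => ?_
      have h3 : (indexMaxDegree x : ℝ) ≤ n := by exact_mod_cast indexMaxDegree_le x
      have h4 : (0 : ℝ) ≤ indexMaxDegree x := Nat.cast_nonneg _
      simp only
      nlinarith
    refine le_of_mul_le_mul_left ?_ hn0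
    linarith
  calc (c * n) ^ k ≤ (∫ x, (indexMaxDegree x : ℝ) ∂(uniformSampleLaw W n)) ^ k := by gcongr
    _ ≤ _ := (convexOn_pow k).map_integral_le (continuous_pow k).continuousOn isClosed_Ici
        (Filter.Eventually.of_forall fun x => Set.mem_Ici.2 (Nat.cast_nonneg _)) (hint fun m => m)
        (hint fun m => (m : ℝ) ^ k)

end Moments

/-! ### Small degrees are unlikely -/

section SmallDegree

variable {M n : ℕ}

theorem le_card_filter_mod (m : ℕ) (t : Fin (m + 1)) :
    n / (m + 1) ≤ (Finset.univ.filter fun j : Fin n => (j : ℕ) % (m + 1) = t).card := by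
  have hlt : ∀ r ∈ Finset.range (n / (m + 1)), (m + 1) * r + t < n := by
    intro r hr
    have h1 : (r + 1) * (m + 1) ≤ n :=
      (Nat.mul_le_mul_right _ (Finset.mem_range.1 hr)).trans (Nat.div_mul_le_self n (m + 1))
    have h2 := t.isLt
    nlinarith
  rw [← Finset.card_range (n / (m + 1)), ← Finset.card_attach]
  refine Finset.card_le_card_of_injOn
    (fun r => (⟨(m + 1) * r.1 + t, hlt r.1 r.2⟩ : Fin n)) (fun r _ => ?_) fun r _ s _ hrs => ?_
  · simp [Nat.mod_eq_of_lt t.isLt]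
  · have := congrArg Fin.val hrs
    simp only [Nat.add_right_cancel_iff] at this
    exact Subtype.ext (Nat.eq_of_mul_eq_mul_left (Nat.succ_pos m) this)

variable {μ : Measure (EuclideanSpace ℝ (Fin M))} [IsProbabilityMeasure μ]
  {κ : Type*} [Fintype κ] {Q : κ → Set (EuclideanSpace ℝ (Fin M))}
  {H : κ → κ → Set (EuclideanSpace ℝ (Fin M))} {q h ζ ν : ℝ}

/-- Clusters exist with high probability once their expected number is large. -/
theorem pi_real_clusterCount_eq_zero_le {E : Type*} [MeasurableSpace E] {μ : Measure E}
    [IsProbabilityMeasure μ] {Q : κ → Set E} (hQ : ∀ v, MeasurableSet (Q v))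
    (hdisj : Pairwise (Function.onFun Disjoint Q)) (hq : ∀ v, μ.real (Q v) = q) (hq0 : 0 ≤ q)
    {r : ℕ} (hr : 0 < r) {b : ℝ} (hb : b = n.choose r * (Fintype.card κ * q ^ r)) (hb0 : 0 < b) :
    (Measure.pi fun _ : Fin n => μ).real {x | clusterCount Q r x = 0} ≤
      2 ^ r * (1 + q) ^ n / b := by
  set P := Measure.pi fun _ : Fin n => μ
  have hm : MeasurableSet {x : Fin n → E | clusterCount Q r x = 0} :=
    measurable_clusterCount hQ r (measurableSet_singleton 0)
  have h1 := integrable_clusterCount (μ := μ) (n := n) hQ r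
  have h2 := integrable_clusterCount_sq (μ := μ) (n := n) hQ r
  have h3 : Integrable (fun x => 2 * b * clusterCount Q r x) P := h1.const_mul _
  have h4 : Integrable (fun x => clusterCount Q r x ^ 2 - 2 * b * clusterCount Q r x) P := h2.sub h3
  have hvar : ∫ x, (clusterCount Q r x ^ 2 - 2 * b * clusterCount Q r x + b ^ 2) ∂P ≤
      b * (2 ^ r * (1 + q) ^ n) := by
    rw [integral_add h4 (integrable_const _), integral_sub h2 h3, integral_const_mul,
      integral_clusterCount hQ hdisj hq hr, ← hb]
    have := integral_clusterCount_sq_le (n := n) hQ hdisj hq hq0 r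
    rw [← hb] at this
    simp only [integral_const, probReal_univ, smul_eq_mul, one_mul]
    linarith
  have hcheb : b ^ 2 * P.real {x | clusterCount Q r x = 0} ≤ b * (2 ^ r * (1 + q) ^ n) := by
    refine le_trans ?_ hvar
    rw [← integral_indicator_one hm, ← integral_const_mul]
    refine integral_mono ((integrable_indicator_one P hm).const_mul _)
      (h4.add (integrable_const _)) fun x => ?_
    by_cases hx : clusterCount Q r x = 0
    · simp [Set.indicator, hx]
    · simp only [Set.indicator, Set.mem_ofPred_eq, hx, if_false, mul_zero]
      nlinarith [sq_nonneg (clusterCount Q r x - b)]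
  rw [le_div_iff₀ hb0]
  refine le_of_mul_le_mul_left ?_ hb0
  linarith

open Classical in
/-- If every residue class mod `m + 1` has an index `j ∉ I` with `x j` in a cell near the cluster,
and the hull of these two cells contains no further sample point, then the cluster has degree at
least `m + 1`. -/
theorem lt_indexDegree_of_forall_residue {κ : Type*}
    {Q : κ → Set (EuclideanSpace ℝ (Fin M))} {H : κ → κ → Set (EuclideanSpace ℝ (Fin M))} {m : ℕ} {x : Fin n → EuclideanSpace ℝ (Fin M)}
    {I : Finset (Fin n)} {v : κ} (near : Finset κ)
    (hconv : ∀ w, convexHull ℝ (Q v ∪ Q w) ⊆ H v w) (hI : ∀ i ∈ I, x i ∈ Q v)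
    (hres : ∀ t : Fin (m + 1), ∃ j, j ∉ I ∧ (j : ℕ) % (m + 1) = t ∧ ∃ w ∈ near, x j ∈ Q w)
    (hempty : ∀ j ∉ I, ∀ w ∈ near, x j ∈ Q w → ∀ l ∉ I, l ≠ j → x l ∉ H v w) :
    m < indexDegree x I := by
  choose j hjI hjt w hw hjw using hres
  have hinj : Function.Injective j := by
    intro s t hst
    exact Fin.ext ((hjt s).symm.trans (hst ▸ hjt t))
  have hcard : (Finset.univ.image j).card = m + 1 := by
    rw [Finset.card_image_of_injective _ hinj, Finset.card_univ, Fintype.card_fin]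
  rw [← Nat.succ_le_iff, Nat.succ_eq_add_one, ← hcard, indexDegree]
  refine Finset.card_le_card fun l hl => ?_
  obtain ⟨t, -, rfl⟩ := Finset.mem_image.1 hl
  refine Finset.mem_filter.2 ⟨Finset.mem_univ _, hjI t, fun l hlI hlj hmem => ?_⟩
  refine hempty (j t) (hjI t) (w t) (hw t) (hjw t) l hlI hlj (hconv _ (convexHull_mono ?_ hmem))
  rintro y (rfl | ⟨i, hi, rfl⟩)
  exacts [Or.inr (hjw t), Or.inl (hI i hi)]

theorem pi_real_cluster_and_avoid_le {E : Type*} [MeasurableSpace E] {μ : Measure E}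
    [IsProbabilityMeasure μ] {A Z : Set E} (hA : μ.real A = q) (hq0 : 0 ≤ q)
    (hZ : MeasurableSet Z)
    (hζ0 : 0 ≤ ζ) (hζ : ζ ≤ μ.real Z) {I T : Finset (Fin n)} {β : ℕ} (hβ : β + I.card ≤ T.card) :
    (Measure.pi fun _ : Fin n => μ).real
      {x | (∀ i ∈ I, x i ∈ A) ∧ ∀ j ∈ T, j ∉ I → x j ∉ Z} ≤ q ^ I.card * (1 - ζ) ^ β := by
  classical
  have hsub : {x : Fin n → E | (∀ i ∈ I, x i ∈ A) ∧ ∀ j ∈ T, j ∉ I → x j ∉ Z} ⊆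
      {x | ∀ i ∈ I ∪ T \ I, x i ∈ if i ∈ I then A else Zᶜ} := by
    rintro x ⟨h1, h2⟩ i hi
    split_ifs with hiI
    · exact h1 i hiI
    · have := Finset.mem_sdiff.1 ((Finset.mem_union.1 hi).resolve_left hiI)
      exact h2 i this.1 hiI
  have hle1 : 1 - μ.real Z ≤ 1 - ζ := by linarith
  have h0 : 0 ≤ 1 - μ.real Z := by linarith [measureReal_le_one (μ := μ) (s := Z)]
  have h1 : 1 - ζ ≤ 1 := by linarith
  have hcard : β ≤ (T \ I).card := by
    have := Finset.le_card_sdiff I T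
    omega
  refine (measureReal_mono hsub).trans ?_
  rw [pi_real_forall_mem, Finset.prod_union Finset.disjoint_sdiff,
    Finset.prod_congr rfl fun i hi => by rw [if_pos hi, hA], Finset.prod_const,
    Finset.prod_congr rfl fun i hi => by
      rw [if_neg (Finset.mem_sdiff.1 hi).2, probReal_compl_eq_one_sub hZ], Finset.prod_const]
  refine mul_le_mul_of_nonneg_left ?_ (by positivity)
  exact (pow_le_pow_left₀ h0 hle1 _).trans (pow_le_pow_of_le_one (h0.trans hle1) h1 hcard)

theorem pi_real_cluster_and_two_le {E : Type*} [MeasurableSpace E] {μ : Measure E}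
    [IsProbabilityMeasure μ] {A B D : Set E} (hA : μ.real A = q) (hB : μ.real B = q)
    (hD : μ.real D ≤ h) (hq0 : 0 ≤ q) {I : Finset (Fin n)} {j l : Fin n}
    (hj : j ∉ I) (hl : l ∉ I) (hlj : l ≠ j) :
    (Measure.pi fun _ : Fin n => μ).real {x | (∀ i ∈ I, x i ∈ A) ∧ x j ∈ B ∧ x l ∈ D} ≤
      q ^ I.card * (q * h) := by
  classical
  have hsub : {x : Fin n → E | (∀ i ∈ I, x i ∈ A) ∧ x j ∈ B ∧ x l ∈ D} ⊆
      {x | ∀ i ∈ insert l (insert j I), x i ∈ if i ∈ I then A else if i = j then B else D} := by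
    rintro x ⟨h1, h2, h3⟩ i hi
    rcases Finset.mem_insert.1 hi with rfl | hi
    · simpa [hl, hlj] using h3
    rcases Finset.mem_insert.1 hi with rfl | hi
    · simpa [hj] using h2
    · simpa [hi] using h1 i hi
  refine (measureReal_mono hsub).trans ?_
  rw [pi_real_forall_mem, Finset.prod_insert (by simp [hl, hlj]), Finset.prod_insert hj,
    if_neg hl, if_neg hlj, if_neg hj, if_pos rfl,
    Finset.prod_congr rfl fun i hi => by rw [if_pos hi, hA], Finset.prod_const, hB]
  calc μ.real D * (q * q ^ I.card) ≤ h * (q * q ^ I.card) := by gcongr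
    _ = _ := by ring

/-- A small degree forces one of three unlikely events: there is no cluster, or some cluster has no
sample point with index in a given residue class nearby, or the convex hull of a cluster cell and
a nearby cell with a sample point contains a further sample point. -/
theorem pi_real_indexMaxDegree_le (hQ : ∀ v, MeasurableSet (Q v))
    (hq : ∀ v, μ.real (Q v) = q) (hq0 : 0 ≤ q) (near : κ → Finset κ)
    (hconv : ∀ v w, convexHull ℝ (Q v ∪ Q w) ⊆ H v w)
    (hh : ∀ v, ∀ w ∈ near v, μ.real (H v w) ≤ h)
    (hζ0 : 0 ≤ ζ) (hζ : ∀ v, ζ ≤ μ.real (⋃ w ∈ near v, Q w))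
    (hν : ∀ v, ((near v).card : ℝ) ≤ ν) (h0 : 0 ≤ h) (m : ℕ) {β : ℕ}
    (hβ : β + M ≤ n / (m + 1)) :
    (Measure.pi fun _ : Fin n => μ).real {x | indexMaxDegree x ≤ m} ≤
      (Measure.pi fun _ : Fin n => μ).real {x | clusterCount Q M x = 0} +
        n.choose M * (Fintype.card κ * q ^ M) *
          ((m + 1) * (1 - ζ) ^ β + n ^ 2 * (ν * (q * h))) := by
  classical
  set P := Measure.pi fun _ : Fin n => μ
  set Z : κ → Set (EuclideanSpace ℝ (Fin M)) := fun v => ⋃ w ∈ near v, Q w with hZ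
  have hZm : ∀ v, MeasurableSet (Z v) := fun v => Finset.measurableSet_biUnion _ fun w _ => hQ w
  set T : Fin (m + 1) → Finset (Fin n) := fun t =>
    Finset.univ.filter fun j : Fin n => (j : ℕ) % (m + 1) = t with hT
  set B₁ : Finset (Fin n) → κ → Fin (m + 1) → Set (Fin n → EuclideanSpace ℝ (Fin M)) :=
    fun I v t => {x | (∀ i ∈ I, x i ∈ Q v) ∧ ∀ j ∈ T t, j ∉ I → x j ∉ Z v} with hB₁
  set B₂ : Finset (Fin n) → κ → κ → Fin n × Fin n → Set (Fin n → EuclideanSpace ℝ (Fin M)) :=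
    fun I v w p => {x | (p.1 ∉ I ∧ p.2 ∉ I ∧ p.2 ≠ p.1) ∧
      (∀ i ∈ I, x i ∈ Q v) ∧ x p.1 ∈ Q w ∧ x p.2 ∈ H v w} with hB₂
  set 𝓘 := (Finset.univ : Finset (Fin n)).powersetCard M with h𝓘
  have hsub : {x | indexMaxDegree x ≤ m} ⊆ {x | clusterCount Q M x = 0} ∪
      ⋃ I ∈ 𝓘, ⋃ v, ((⋃ t, B₁ I v t) ∪ ⋃ w ∈ near v, ⋃ p, B₂ I v w p) := by
    intro x hx
    by_cases hex : ∃ I ∈ 𝓘, x ∈ clusterEvent Q I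
    · obtain ⟨I, hI, v, hv⟩ := hex
      refine Or.inr (Set.mem_iUnion₂.2 ⟨I, hI, Set.mem_iUnion.2 ⟨v, ?_⟩⟩)
      by_contra hcon
      simp only [Set.mem_union, Set.mem_iUnion, not_or, not_exists] at hcon
      have hlt : m < indexDegree x I := by
        refine lt_indexDegree_of_forall_residue (near v) (hconv v) hv (fun t => ?_)
          fun j hj w hw hjw l hl hlj hlH =>
            hcon.2 w hw (j, l) ⟨⟨hj, hl, hlj⟩, hv, hjw, hlH⟩
        by_contra hno
        refine hcon.1 t ⟨hv, fun j hj hjI hjZ => hno ⟨j, hjI, (Finset.mem_filter.1 hj).2, ?_⟩⟩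
        obtain ⟨w, hw, hjw⟩ := Set.mem_iUnion₂.1 hjZ
        exact ⟨w, hw, hjw⟩
      have hle := indexDegree_le_indexMaxDegree x (Finset.mem_powersetCard.1 hI).2
      have hx' : indexMaxDegree x ≤ m := hx
      omega
    · refine Or.inl (Finset.sum_eq_zero fun I hI => Set.indicator_of_notMem ?_ _)
      exact fun hmem => hex ⟨I, hI, hmem⟩
  refine (measureReal_mono hsub).trans ((measureReal_union_le _ _).trans ?_)
  gcongr
  have hB₁le : ∀ I ∈ 𝓘, ∀ v t, P.real (B₁ I v t) ≤ q ^ M * (1 - ζ) ^ β := by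
    intro I hI v t
    have hc := (Finset.mem_powersetCard.1 hI).2
    have hc' : q ^ I.card = q ^ M := by rw [hc]
    rw [← hc']
    exact pi_real_cluster_and_avoid_le (hq v) hq0 (hZm v) hζ0 (hζ v)
      (by rw [hc]; exact hβ.trans (le_card_filter_mod m t))
  have hB₂le : ∀ I ∈ 𝓘, ∀ v, ∀ w ∈ near v, ∀ p, P.real (B₂ I v w p) ≤ q ^ M * (q * h) := by
    intro I hI v w hw p
    have hc := (Finset.mem_powersetCard.1 hI).2
    by_cases hp : p.1 ∉ I ∧ p.2 ∉ I ∧ p.2 ≠ p.1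
    · have hc' : q ^ I.card = q ^ M := by rw [hc]
      rw [← hc']
      exact (measureReal_mono fun x hx => hx.2).trans
        (pi_real_cluster_and_two_le (hq v) (hq w) (hh v w hw) hq0 hp.1 hp.2.1 hp.2.2)
    · have : B₂ I v w p = ∅ := Set.eq_empty_of_forall_notMem fun x hx => hp hx.1
      rw [this, measureReal_empty]
      positivity
  have hone : ∀ I ∈ 𝓘, ∀ v,
      P.real ((⋃ t, B₁ I v t) ∪ ⋃ w ∈ near v, ⋃ p, B₂ I v w p) ≤
        q ^ M * ((m + 1) * (1 - ζ) ^ β + n ^ 2 * (ν * (q * h))) := by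
    intro I hI v
    refine (measureReal_union_le _ _).trans ?_
    have e1 : P.real (⋃ t, B₁ I v t) ≤ (m + 1) * (q ^ M * (1 - ζ) ^ β) := by
      refine (measureReal_iUnion_fintype_le _).trans
        ((Finset.sum_le_sum fun t _ => hB₁le I hI v t).trans (le_of_eq ?_))
      simp
    have e2 : P.real (⋃ w ∈ near v, ⋃ p, B₂ I v w p) ≤
        ν * (n ^ 2 * (q ^ M * (q * h))) := by
      refine (measureReal_biUnion_finset_le _ _).trans ((Finset.sum_le_sum fun w hw =>
        (measureReal_iUnion_fintype_le _).trans
          (Finset.sum_le_sum fun p _ => hB₂le I hI v w hw p)).trans ?_)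
      simp only [Finset.sum_const, Finset.card_univ, Fintype.card_prod, Fintype.card_fin,
        nsmul_eq_mul]
      push_cast
      rw [← sq]
      exact mul_le_mul_of_nonneg_right (hν v) (by positivity)
    calc _ ≤ (m + 1) * (q ^ M * (1 - ζ) ^ β) + ν * (n ^ 2 * (q ^ M * (q * h))) := add_le_add e1 e2
      _ = _ := by ring
  refine (measureReal_biUnion_finset_le _ _).trans ((Finset.sum_le_sum fun I hI =>
    (measureReal_iUnion_fintype_le _).trans
      (Finset.sum_le_sum fun v _ => hone I hI v)).trans (le_of_eq ?_))
  simp only [h𝓘, Finset.sum_const, Finset.card_univ, Finset.card_powersetCard, Fintype.card_fin,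
    nsmul_eq_mul]
  ring

end SmallDegree

/-! ### Neighbouring cells -/

section Near

variable {M L : ℕ}

/-- The cells whose index differs from `v` by at most `J` in every coordinate. -/
def nearCells (J : ℕ) (v : Fin M → Fin L) : Finset (Fin M → Fin L) :=
  Fintype.piFinset fun i => Finset.univ.filter fun a : Fin L =>
    (a : ℕ) ≤ v i + J ∧ (v i : ℕ) ≤ a + J

theorem le_card_nearCells {J : ℕ} (hJ : J ≤ L) (v : Fin M → Fin L) :
    J ^ M ≤ (nearCells J v).card := by
  rw [nearCells, Fintype.card_piFinset]
  calc J ^ M = ∏ _i : Fin M, J := by simp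
    _ ≤ _ := Finset.prod_le_prod' fun i _ => ?_
  -- an interval of `J` indices that starts at `v i` or, close to the upper end, at `L - J`
  have hlt : ∀ r ∈ Finset.range J, min (v i : ℕ) (L - J) + r < L := by
    intro r hr
    have := Finset.mem_range.1 hr
    omega
  refine le_trans (b := (Finset.range J).attach.card) (by simp) ?_
  refine Finset.card_le_card_of_injOn
    (fun r => (⟨min (v i : ℕ) (L - J) + r.1, hlt r.1 r.2⟩ : Fin L)) (fun r _ => ?_)
    fun r _ s _ hrs => ?_
  · have h1 := Finset.mem_range.1 r.2
    have h2 := (v i).isLt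
    simp only [Finset.coe_filter, Finset.mem_univ, true_and,
      Set.mem_ofPred_eq]
    omega
  · have := congrArg Fin.val hrs
    simp only at this
    exact Subtype.ext (by omega)

theorem card_nearCells_le (J : ℕ) (v : Fin M → Fin L) :
    (nearCells J v).card ≤ (2 * J + 1) ^ M := by
  rw [nearCells, Fintype.card_piFinset]
  calc _ ≤ ∏ _i : Fin M, (2 * J + 1) := Finset.prod_le_prod' fun i _ => ?_
    _ = _ := by simp
  have : (Finset.Icc ((v i : ℕ) - J) (v i + J)).card ≤ 2 * J + 1 := by
    rw [Nat.card_Icc]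
    omega
  refine le_trans (Finset.card_le_card_of_injOn Fin.val (fun a ha => ?_)
    Fin.val_injective.injOn) this
  have := (Finset.mem_filter.1 ha).2
  simp only [Finset.coe_Icc, Set.mem_Icc]
  omega

theorem abs_sub_le_of_mem_nearCells {J : ℕ} {v w : Fin M → Fin L} (hw : w ∈ nearCells J v)
    (i : Fin M) : |((v i : ℕ) : ℝ) - (w i : ℕ)| ≤ J := by
  obtain ⟨h1, h2⟩ := (Finset.mem_filter.1 (Fintype.mem_piFinset.1 hw i)).2
  have h1' : ((w i : ℕ) : ℝ) ≤ (v i : ℕ) + J := by exact_mod_cast h1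
  have h2' : ((v i : ℕ) : ℝ) ≤ (w i : ℕ) + J := by exact_mod_cast h2
  rw [abs_le]
  constructor <;> linarith

end Near

/-! ### Divergence in probability -/

section Divergence

variable {M : ℕ} {W : Set (EuclideanSpace ℝ (Fin M))}

theorem one_sub_pow_le_one_div {ζ : ℝ} (h0 : 0 < ζ) (h1 : ζ ≤ 1) {β : ℝ} (hβ : 0 < β) {k : ℕ}
    (hk : β ≤ k) : (1 - ζ) ^ k ≤ 1 / (β * ζ) := by
  have hb := one_add_mul_le_pow (by linarith : (-2 : ℝ) ≤ ζ) k
  have hprod : (1 - ζ) ^ k * (1 + ζ) ^ k ≤ 1 := by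
    rw [← mul_pow]
    exact pow_le_one₀ (by nlinarith) (by nlinarith)
  have h2 : β * ζ ≤ (1 + ζ) ^ k := by nlinarith
  rw [le_div_iff₀ (by positivity)]
  exact (mul_le_mul_of_nonneg_left h2 (pow_nonneg (by linarith) k)).trans hprod

/-- With about `t ^ M` expected clusters, and cells near a cluster containing about `R * t`
expected sample points, a degree of at most `m` has three sources: no cluster, no nearby sample
points, and nearby simplices that are not empty. The last one disappears as `L → ∞`. -/
theorem exists_uniformSampleLaw_real_le (hM : 2 ≤ M) (hW : IsCompact W)
    (hW_int : (interior W).Nonempty) [IsProbabilityMeasure (cond volume W)] (m : ℕ) :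
    ∃ C₁ C₂ : ℝ, 0 < C₁ ∧ 0 < C₂ ∧ ∀ t R : ℕ, 0 < t → 0 < R → ∃ C₃ : ℝ, 0 < C₃ ∧
      ∃ L₀ : ℕ, ∀ n L J : ℕ, 2 * M ≤ n → 2 * (m + M * (m + 1)) ≤ n → L₀ ≤ L → 0 < L →
        n ≤ t * L ^ (M - 1) → t * L ^ (M - 1) ≤ 2 ^ (M - 1) * n →
        0 < J → R * L ≤ J ^ M → J ^ M ≤ 2 ^ M * (R * L) →
        (uniformSampleLaw W n).real {x | indexMaxDegree x ≤ m} ≤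
          C₁ / (t : ℝ) ^ M + C₂ * (t : ℝ) ^ M / R + C₃ * (J / L) := by
  obtain ⟨q₀, hq₀, hcells⟩ := exists_cells hW hW_int
  set c₁ : ℝ := q₀ ^ M / (M.factorial * (2 * 2 ^ (M - 1)) ^ M) with hc₁
  have hc₁0 : 0 < c₁ := by positivity
  refine ⟨2 ^ M * Real.exp q₀ / c₁, q₀ ^ M * (2 * (m + 1) ^ 2 * 2 ^ (M - 1) / q₀),
    by positivity, by positivity, fun t R ht hR => ?_⟩
  have ht' : (0 : ℝ) < t := by exact_mod_cast ht
  have hR' : (0 : ℝ) < R := by exact_mod_cast hR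
  refine ⟨q₀ ^ M * (t : ℝ) ^ M * ((t * q₀) ^ 2 * (3 ^ M * (2 ^ M * R)) * (2 * 3 ^ M)),
    by positivity, max t (2 ^ M * R), fun n L J hn1 hn2 hL₀ hL hnL hLn hJ hJ1 hJ2 => ?_⟩
  have htL : t ≤ L := (le_max_left _ _).trans hL₀
  have hL' : (0 : ℝ) < L := by exact_mod_cast hL
  have hJ' : (0 : ℝ) < J := by exact_mod_cast hJ
  have hJ1' : (1 : ℝ) ≤ J := by exact_mod_cast hJ
  have hn0 : (0 : ℝ) < n := by exact_mod_cast (by omega : 0 < n)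
  have hJL : J ≤ L := by
    refine le_of_pow_le_pow_left₀ (by omega : M ≠ 0) (Nat.zero_le _) ?_
    calc J ^ M ≤ 2 ^ M * R * L := by rw [mul_assoc]; exact hJ2
      _ ≤ L * L := by gcongr; exact (le_max_right _ _).trans hL₀
      _ = L ^ 2 := (sq L).symm
      _ ≤ L ^ M := Nat.pow_le_pow_right hL hM
  obtain ⟨Q, hQ, hdisj, hq, hconv⟩ := hcells L hL
  set q : ℝ := q₀ / (L : ℝ) ^ M with hqdef
  have hq0 : 0 < q := by positivity
  -- only an upper bound for the measure of `H v w` is needed, so `H v w` can be the hull itself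
  set H : (Fin M → Fin L) → (Fin M → Fin L) → Set (EuclideanSpace ℝ (Fin M)) :=
    fun v w => convexHull ℝ (Q v ∪ Q w) with hH
  set h : ℝ := (J + 1) * 3 ^ M * q with hh
  have hhle : ∀ v, ∀ w ∈ nearCells J v, (cond volume W).real (H v w) ≤ h := by
    intro v w hw
    obtain ⟨H', -, hsub, hle⟩ := hconv J hJ v w (abs_sub_le_of_mem_nearCells hw)
    exact (measureReal_mono hsub).trans hle
  set ζ : ℝ := (J : ℝ) ^ M * q with hζ
  have hζ0 : 0 < ζ := by positivity
  have hζle : ∀ v, ζ ≤ (cond volume W).real (⋃ w ∈ nearCells J v, Q w) := by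
    intro v
    rw [measureReal_biUnion_finset (fun a _ b _ hab => hdisj hab) fun w _ => hQ w,
      Finset.sum_congr rfl fun w _ => hq w, Finset.sum_const, nsmul_eq_mul]
    exact mul_le_mul_of_nonneg_right (by exact_mod_cast le_card_nearCells hJL v) hq0.le
  have hζ1 : ζ ≤ 1 := (hζle fun _ => ⟨0, hL⟩).trans measureReal_le_one
  have hν : ∀ v : Fin M → Fin L, ((nearCells J v).card : ℝ) ≤ (3 * J) ^ M := by
    intro v
    exact_mod_cast (card_nearCells_le J v).trans (Nat.pow_le_pow_left (by omega) M)
  set β : ℕ := n / (m + 1) - M with hβ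
  have hMle : M ≤ n / (m + 1) := by
    refine (Nat.le_div_iff_mul_le (Nat.succ_pos m)).2 (?_ : M * (m + 1) ≤ n)
    omega
  have hβ' : (n : ℝ) / (2 * (m + 1)) ≤ β := by
    have h1 := Nat.div_add_mod n (m + 1)
    have h2 := Nat.mod_lt n (Nat.succ_pos m)
    have h3 : (m + 1) * (β + M) + n % (m + 1) = n := by
      rw [hβ, Nat.sub_add_cancel hMle]
      exact h1
    have h4 : n ≤ β * (2 * (m + 1)) := by nlinarith
    rw [div_le_iff₀ (by positivity)]
    exact_mod_cast h4
  have hmain := pi_real_indexMaxDegree_le (n := n) hQ hq hq0.le (nearCells J)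
    (fun v w => (subset_refl (H v w))) hhle hζ0.le hζle hν (by positivity) m (β := β) (by omega)
  have hcard : (Fintype.card (Fin M → Fin L) : ℝ) = (L : ℝ) ^ M := by simp
  rw [hcard] at hmain
  change (uniformSampleLaw W n).real _ ≤ (uniformSampleLaw W n).real _ +
    expectedClusters M n L q₀ * _ at hmain
  have hb1 : c₁ * (t : ℝ) ^ M ≤ expectedClusters M n L q₀ :=
    le_expectedClusters (by omega) hq₀ ht hL hLn hn1
  have hb2 : expectedClusters M n L q₀ ≤ q₀ ^ M * (t : ℝ) ^ M :=
    expectedClusters_le (by omega) hq₀ hL hnL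
  have hb0 : 0 < expectedClusters M n L q₀ := lt_of_lt_of_le (by positivity) hb1
  have hzero : (uniformSampleLaw W n).real {x | clusterCount Q M x = 0} ≤
      2 ^ M * Real.exp q₀ / c₁ / (t : ℝ) ^ M := by
    refine (pi_real_clusterCount_eq_zero_le hQ hdisj hq hq0.le (by omega)
      (b := expectedClusters M n L q₀) (by rw [hcard]; rfl) hb0).trans ?_
    rw [div_div]
    gcongr
    exact one_add_cell_pow_le (by omega) hq₀ hL htL hnL
  have hnL' : (n : ℝ) * q ≤ t * q₀ / L := natCast_mul_cell_le (by omega) hq₀ hL hnL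
  have hterm1 : ((m : ℝ) + 1) * (1 - ζ) ^ β ≤ 2 * (m + 1) ^ 2 * 2 ^ (M - 1) / q₀ / R := by
    have h1 := one_sub_pow_le_one_div hζ0 hζ1 (by positivity) hβ'
    have h2 : (R : ℝ) * q₀ / 2 ^ (M - 1) ≤ n * ζ := by
      have hLn' : (t : ℝ) * (L : ℝ) ^ (M - 1) ≤ 2 ^ (M - 1) * n := by exact_mod_cast hLn
      have ht1 : (1 : ℝ) ≤ t := by exact_mod_cast ht
      have hJ1'' : (R : ℝ) * L ≤ (J : ℝ) ^ M := by exact_mod_cast hJ1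
      have h3 : (L : ℝ) ^ (M - 1) ≤ 2 ^ (M - 1) * n :=
        le_trans (le_mul_of_one_le_left (by positivity) ht1) hLn'
      rw [div_le_iff₀ (by positivity)]
      calc (R : ℝ) * q₀ = (L : ℝ) ^ (M - 1) * (R * L * q) := by
            rw [hqdef]
            obtain ⟨e, rfl⟩ : ∃ e, M = e + 1 := ⟨M - 1, by omega⟩
            rw [Nat.add_sub_cancel, pow_succ]
            field_simp
        _ ≤ 2 ^ (M - 1) * n * ((J : ℝ) ^ M * q) := by gcongr
        _ = n * ζ * 2 ^ (M - 1) := by rw [hζ]; ring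
    calc ((m : ℝ) + 1) * (1 - ζ) ^ β ≤ (m + 1) * (1 / (n / (2 * (m + 1)) * ζ)) := by gcongr
      _ = 2 * (m + 1) ^ 2 / (n * ζ) := by field_simp
      _ ≤ 2 * (m + 1) ^ 2 / (R * q₀ / 2 ^ (M - 1)) := by gcongr
      _ = _ := by field_simp
  have hterm2 : (n : ℝ) ^ 2 * ((3 * J) ^ M * (q * h)) ≤
      (t * q₀) ^ 2 * (3 ^ M * (2 ^ M * R)) * (2 * 3 ^ M) * (J / L) := by
    have hJ2' : (J : ℝ) ^ M ≤ 2 ^ M * (R * L) := by exact_mod_cast hJ2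
    calc (n : ℝ) ^ 2 * ((3 * J) ^ M * (q * h))
        = (n * q) ^ 2 * (3 ^ M * (J : ℝ) ^ M) * ((J + 1) * 3 ^ M) := by
          rw [hh, mul_pow]; ring
      _ ≤ (t * q₀ / L) ^ 2 * (3 ^ M * (2 ^ M * (R * L))) * ((J + J) * 3 ^ M) := by gcongr
      _ = _ := by
        field_simp
        ring
  refine hmain.trans ?_
  rw [add_assoc]
  refine add_le_add hzero ?_
  calc _ ≤ q₀ ^ M * (t : ℝ) ^ M * (2 * (m + 1) ^ 2 * 2 ^ (M - 1) / q₀ / R +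
        (t * q₀) ^ 2 * (3 ^ M * (2 ^ M * R)) * (2 * 3 ^ M) * (J / L)) := by
        have : 0 ≤ (1 - ζ) ^ β := pow_nonneg (by linarith) _
        gcongr
    _ = _ := by ring

theorem tendsto_uniformSampleLaw_real (hM : 2 ≤ M) (hW : IsCompact W)
    (hW_int : (interior W).Nonempty) [IsProbabilityMeasure (cond volume W)] (m : ℕ) :
    Tendsto (fun n => (uniformSampleLaw W n).real {x | indexMaxDegree x ≤ m}) atTop (𝓝 0) := by
  obtain ⟨C₁, C₂, hC₁, hC₂, hbound⟩ := exists_uniformSampleLaw_real_le hM hW hW_int m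
  rw [Metric.tendsto_atTop]
  intro ε hε
  -- `t` makes the first term small, then `R` the second; the third is small for large `L`, because
  -- `(J / L) ^ M ≤ 2 ^ M * R / L ^ (M - 1)`
  obtain ⟨t, ht⟩ := exists_nat_gt (max 1 (C₁ / (ε / 3)))
  have ht1 : (1 : ℝ) < t := (le_max_left _ _).trans_lt ht
  have ht0 : 0 < t := by exact_mod_cast zero_lt_one.trans ht1
  have htε : C₁ / (t : ℝ) ^ M < ε / 3 := by
    have h1 : (t : ℝ) ≤ (t : ℝ) ^ M := le_self_pow₀ ht1.le (by omega)
    have h2 := ((le_max_right _ _).trans_lt ht).trans_le h1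
    rw [div_lt_iff₀ (by positivity)] at h2 ⊢
    linarith
  obtain ⟨R, hR⟩ := exists_nat_gt (C₂ * (t : ℝ) ^ M / (ε / 3))
  have hR0' : (0 : ℝ) < R := lt_of_le_of_lt (by positivity) hR
  have hR0 : 0 < R := by exact_mod_cast hR0'
  have hRε : C₂ * (t : ℝ) ^ M / R < ε / 3 := by
    rw [div_lt_iff₀ (by positivity)] at hR ⊢
    linarith
  obtain ⟨C₃, hC₃, L₀, hL₀⟩ := hbound t R ht0 hR0
  set η : ℝ := ε / 3 / C₃ with hη
  have hη0 : 0 < η := by positivity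
  obtain ⟨L₁, hL₁⟩ := exists_nat_gt (2 ^ M * R / η ^ M)
  set L₂ : ℕ := max L₀ L₁ with hL₂
  refine ⟨max (max (2 * M) (2 * (m + M * (m + 1)))) (max t (t * L₂ ^ (M - 1) + 1)),
    fun n hn => ?_⟩
  obtain ⟨⟨hn1, hn2⟩, hn3, hn4⟩ := by simpa only [ge_iff_le, max_le_iff] using hn
  obtain ⟨L, hL, hnL, hLn⟩ := exists_pow_between (e := M - 1) (by omega) ht0 hn3
  obtain ⟨J, hJ, hJ1, hJ2⟩ := exists_pow_between (e := M) (t := 1) (n := R * L) (by omega)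
    one_pos (Nat.mul_pos hR0 hL)
  rw [one_mul] at hJ1 hJ2
  have hL2 : L₂ ≤ L := by
    by_contra hlt
    have : t * L ^ (M - 1) ≤ t * L₂ ^ (M - 1) :=
      Nat.mul_le_mul_left _ (Nat.pow_le_pow_left (by omega) _)
    omega
  have hL' : (0 : ℝ) < L := by exact_mod_cast hL
  have hJL : (J : ℝ) / L ≤ η := by
    have h1 : 2 ^ M * R / η ^ M < L :=
      hL₁.trans_le (by exact_mod_cast (le_max_right L₀ L₁).trans hL2)
    rw [div_lt_iff₀ (by positivity)] at h1
    have hJ2' : (J : ℝ) ^ M ≤ 2 ^ M * (R * L) := by exact_mod_cast hJ2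
    have hLM : (L : ℝ) ^ 2 ≤ (L : ℝ) ^ M := pow_le_pow_right₀ (by exact_mod_cast hL) hM
    refine le_of_pow_le_pow_left₀ (by omega : M ≠ 0) hη0.le ?_
    rw [div_pow, div_le_iff₀ (by positivity)]
    calc (J : ℝ) ^ M ≤ 2 ^ M * R * L := by linarith
      _ ≤ L * η ^ M * L := by gcongr
      _ = η ^ M * (L : ℝ) ^ 2 := by ring
      _ ≤ η ^ M * (L : ℝ) ^ M := by gcongr
  have hlast : C₃ * (J / L) ≤ ε / 3 := by
    calc C₃ * (J / L) ≤ C₃ * η := by gcongr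
      _ = ε / 3 := by rw [hη]; field_simp
  have := hL₀ n L J hn1 hn2 ((le_max_left _ _).trans hL2) hL hnL hLn hJ hJ1 hJ2
  rw [Real.dist_0_eq_abs, abs_of_nonneg measureReal_nonneg]
  linarith

end Divergence

theorem theorem1 (M : ℕ) (hM : 2 ≤ M) (W : Set (EuclideanSpace ℝ (Fin M)))
    (hW_compact : IsCompact W) (hW_convex : Convex ℝ W) (hW_int : (interior W).Nonempty) :
    (∃ N : ℕ, ∀ k : ℕ, ∃ c : ℝ, 0 < c ∧ ∀ n : ℕ, N ≤ n →
      c * (n : ℝ) ^ k / Real.log n ≤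
        ∫ x, (maxDegree (sampleSet x) : ℝ) ^ k ∂(uniformSampleLaw W n)) ∧
    (∀ m : ℕ, Tendsto (fun n : ℕ => uniformSampleLaw W n {x | maxDegree (sampleSet x) ≤ m})
      atTop (𝓝 0)) := by
  have hpos : volume W ≠ 0 := ((isOpen_interior.measure_pos volume hW_int).trans_le
    (measure_mono interior_subset)).ne'
  have hprob : IsProbabilityMeasure (cond volume W) :=
    cond_isProbabilityMeasure_of_finite hpos hW_compact.measure_lt_top.ne
  have hnull : NullSingletonClass (cond volume W) := by
    have : Nonempty (Fin M) := ⟨⟨0, by omega⟩⟩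
    exact ⟨fun x => cond_absolutelyContinuous (measure_singleton x)⟩
  have hae : ∀ n : ℕ, ∀ᵐ x ∂(uniformSampleLaw W n), maxDegree (sampleSet x) = indexMaxDegree x :=
    fun n => (ae_injective_pi (cond volume W)).mono fun x hx => maxDegree_sampleSet hx
  have hP : ∀ n, IsProbabilityMeasure (uniformSampleLaw W n) := fun n => by
    unfold uniformSampleLaw; infer_instance
  refine ⟨?_, fun m => ?_⟩
  · obtain ⟨c, hc, N, hN⟩ := exists_le_integral_indexMaxDegree_pow hM hW_compact hW_int
    refine ⟨max N 3, fun k => ⟨c ^ k, by positivity, fun n hn => ?_⟩⟩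
    have hlog : 1 ≤ Real.log n := by
      rw [Real.le_log_iff_exp_le (by exact_mod_cast (by omega : 0 < n))]
      have h3 : (3 : ℝ) ≤ n := by exact_mod_cast (le_max_right N 3).trans hn
      linarith [Real.exp_one_lt_d9]
    have hint : ∫ x, (maxDegree (sampleSet x) : ℝ) ^ k ∂(uniformSampleLaw W n) =
        ∫ x, (indexMaxDegree x : ℝ) ^ k ∂(uniformSampleLaw W n) :=
      integral_congr_ae ((hae n).mono fun x hx => by simp only [hx])
    rw [hint, ← mul_pow]
    exact (div_le_self (by positivity) hlog).trans (hN n ((le_max_left _ _).trans hn) k)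
  · have hset : ∀ n, uniformSampleLaw W n {x | maxDegree (sampleSet x) ≤ m} =
        ENNReal.ofReal ((uniformSampleLaw W n).real {x | indexMaxDegree x ≤ m}) := by
      intro n
      rw [ofReal_measureReal]
      exact measure_congr (Filter.eventuallyEq_set.2 ((hae n).mono fun x hx => by
        simp only [Set.mem_ofPred_eq, hx]))
    simp only [hset]
    simpa using ENNReal.tendsto_ofReal (tendsto_uniformSampleLaw_real hM hW_compact hW_int m)
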